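/- Let $N$ be a simply connected nilpotent Lie group, let $G$ be a finite group acting on $N$ by Lie group automorphisms, let $\Gamma$ be a torsion-free discrete cocompact subgroup of $N\rtimes G$, and let $M = G\backslash (N\rtimes G)/\Gamma$ be the corresponding infranilmanifold. Identify $N$ with $G\backslash (N\rtimes G)$, so that $\Gamma$ acts on $N$ from the right with $M = N/\Gamma$. Let $L\colon M\to M$ be an Anosov automorphism, that is, a map induced by an affine map $x\mapsto v\,\widetilde L(x)$ of $N$, where $v\in N$ and $\widetilde L$ is an automorphism of the Lie group $N$ whose differential at the identity has no complex eigenvalue of absolute value $1$, and where conjugation by the affine map carries the transformation group $\Gamma$ of $N$ onto itself. Let $h\colon M\to M$ be a homeomorphism that is homotopic to $\mathrm{id}_M$ and satisfies $h\circ L = L\circ h$. Then $h$ is isotopic to $\mathrm{id}_M$, i.e. there is a continuous map $H\colon [0,1]\times M\to M$ with $H(0,\cdot)=h$, $H(1,\cdot)=\mathrm{id}_M$ and every $H(t,\cdot)$ a homeomorphism of $M$. -/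

import Mathlib

open scoped Manifold ContDiff TensorProduct

/-- The product topology on the semidirect product `N ⋊ G`. -/
instance SemidirectProduct.instProductTopology {N G : Type*} [Group N] [Group G]
    [TopologicalSpace N] [TopologicalSpace G] (φ : G →* MulAut N) :
    TopologicalSpace (N ⋊[φ] G) :=
  TopologicalSpace.induced SemidirectProduct.equivProd inferInstance

/-- `Γ` is a torsion-free discrete cocompact subgroup of `N ⋊ G`. -/
structure IsInfranilGroup {N G : Type*} [Group N] [Group G]
    [TopologicalSpace N] [TopologicalSpace G] (φ : G →* MulAut N)
    (Γ : Subgroup (N ⋊[φ] G)) : Prop where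
  discrete : DiscreteTopology Γ
  cocompact : CompactSpace ((N ⋊[φ] G) ⧸ Γ)
  torsionFree : ∀ γ ∈ Γ, IsOfFinOrder γ → γ = 1

/-- The double coset space `G \ (N ⋊ G) / Γ`. -/
def Infranilmanifold {N G : Type*} [Group N] [Group G] (φ : G →* MulAut N)
    (Γ : Subgroup (N ⋊[φ] G)) : Type _ :=
  DoubleCoset.Quotient
    ((SemidirectProduct.inr : G →* N ⋊[φ] G).range : Set (N ⋊[φ] G)) (Γ : Set (N ⋊[φ] G))

/-- The quotient topology on `G \ (N ⋊ G) / Γ`. -/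
instance Infranilmanifold.instTopologicalSpace {N G : Type*} [Group N] [Group G]
    [TopologicalSpace N] [TopologicalSpace G] (φ : G →* MulAut N)
    (Γ : Subgroup (N ⋊[φ] G)) : TopologicalSpace (Infranilmanifold φ Γ) :=
  TopologicalSpace.coinduced
    (DoubleCoset.mk (SemidirectProduct.inr : G →* N ⋊[φ] G).range Γ) inferInstance

/-- The projection `N = G \ (N ⋊ G) → G \ (N ⋊ G) / Γ`, the universal covering map. -/
def Infranilmanifold.proj {N G : Type*} [Group N] [Group G] (φ : G →* MulAut N)
    (Γ : Subgroup (N ⋊[φ] G)) (x : N) : Infranilmanifold φ Γ :=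
  DoubleCoset.mk (SemidirectProduct.inr : G →* N ⋊[φ] G).range Γ (SemidirectProduct.inl x)

/-- The right action of `γ = (m, k)` on `N = G \ (N ⋊ G)`, namely
`G (x, 1) (m, k) = G (x m, k) = G (k⁻¹ (x m), 1)`. -/
def infranilRightAct {N G : Type*} [Group N] [Group G] (φ : G →* MulAut N)
    (γ : N ⋊[φ] G) (x : N) : N :=
  φ γ.right⁻¹ (x * γ.left)

/-- `A` is an automorphism of the Lie group `N`. -/
def IsLieAutomorphism {E N : Type*} [NormedAddCommGroup E] [NormedSpace ℝ E]
    [TopologicalSpace N] [ChartedSpace E N] [Group N] (A : MulAut N) : Prop :=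
  ContMDiff 𝓘(ℝ, E) 𝓘(ℝ, E) ∞ (A : N → N) ∧ ContMDiff 𝓘(ℝ, E) 𝓘(ℝ, E) ∞ (A⁻¹ : MulAut N)

/-- The differential at the identity of a map `A : N → N` with `A 1 = 1`, as an endomorphism of
the model space, to which `TangentSpace 𝓘(ℝ, E) (1 : N)` unfolds. -/
noncomputable def differentialAtOne {E N : Type*} [NormedAddCommGroup E] [NormedSpace ℝ E]
    [TopologicalSpace N] [ChartedSpace E N] [Group N] (A : N → N) : Module.End ℝ E :=
  let D : E →L[ℝ] E := mfderiv 𝓘(ℝ, E) 𝓘(ℝ, E) A (1 : N)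
  D.toLinearMap

/-- No complex eigenvalue of the differential of `A` at the identity has absolute value `1`. -/
def IsHyperbolicAut {E N : Type*} [NormedAddCommGroup E] [NormedSpace ℝ E]
    [TopologicalSpace N] [ChartedSpace E N] [Group N] (A : MulAut N) : Prop :=
  ∀ μ : ℂ, Module.End.HasEigenvalue
    ((differentialAtOne (E := E) (A : N → N)).baseChange ℂ : Module.End ℂ (ℂ ⊗[ℝ] E)) μ → ‖μ‖ ≠ 1

/-- `T` carries the group of transformations `{x ↦ x · γ | γ ∈ Γ}` of `N` onto itself by
conjugation. -/
def NormalizesInfranilGroup {N G : Type*} [Group N] [Group G] (φ : G →* MulAut N)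
    (Γ : Subgroup (N ⋊[φ] G)) (T : N → N) : Prop :=
  (∀ γ ∈ Γ, ∃ γ' ∈ Γ, ∀ x, T (infranilRightAct φ γ x) = infranilRightAct φ γ' (T x)) ∧
  (∀ γ' ∈ Γ, ∃ γ ∈ Γ, ∀ x, T (infranilRightAct φ γ x) = infranilRightAct φ γ' (T x))

/-- `L` is induced on `G \ (N ⋊ G) / Γ` by an affine map `x ↦ v * A x` of `N` compatible with `Γ`
whose linear part `A` is a hyperbolic automorphism. -/
def IsAnosovAutomorphism {E N G : Type*} [NormedAddCommGroup E] [NormedSpace ℝ E]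
    [TopologicalSpace N] [ChartedSpace E N] [Group N] [Group G] (φ : G →* MulAut N)
    (Γ : Subgroup (N ⋊[φ] G)) (L : Infranilmanifold φ Γ → Infranilmanifold φ Γ) : Prop :=
  ∃ (v : N) (A : MulAut N), IsLieAutomorphism (E := E) A ∧ IsHyperbolicAut (E := E) A ∧
    NormalizesInfranilGroup φ Γ (fun x => v * A x) ∧
    ∀ x : N, L (Infranilmanifold.proj φ Γ x) = Infranilmanifold.proj φ Γ (v * A x)

/-- Two self-homeomorphisms are isotopic if they are homotopic through homeomorphisms. -/
def AreIsotopic {X : Type*} [TopologicalSpace X] (f g : X ≃ₜ X) : Prop :=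
  ContinuousMap.HomotopicWith (f : C(X, X)) (g : C(X, X)) (fun k => IsHomeomorph k)

/-!
The map `h` lifts to a map `H` of `N` which commutes with `Γ` (lift the homotopy to the identity,
`IsInfranilGroup.exists_equivariant_lift`), hence is at bounded distance from the identity: the
function `c x = H x * x⁻¹` has relatively compact range. If `T` is the affine map inducing `L`, then
`H ∘ T` and `T ∘ H` lift the same map, so they differ by an element of `Γ`. A cocycle with values in
the finite holonomy group measures how this element acts, and after passing to a power of `T` it
acts by a right translation commuting with `Γ` (`exists_iterate_comm`), that is, by a bounded
conjugacy class, hence by a central element `m`. Now `c (T ^ n x) = B (c x) * m`, where `B` is the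
linear part `x ↦ v * A x * v⁻¹` of `T`, raised to the power `n`. So the differences
`c x * (c y)⁻¹` have bounded two-sided orbits under the hyperbolic automorphism `B`, which forces `c`
to be constant: `H` is the left translation by some `c₀`, and `c₀` is fixed by the holonomy group.
A path from `c₀` to `1` in the fixed subgroup of the holonomy group gives the isotopy.

The facts about `N` used here (trivial bounded orbits of hyperbolic automorphisms, centrality of
bounded conjugacy classes, path connectedness of fixed subgroups of finite groups) are usually read
off from the exponential map. The proof replaces it by the square root. The adjoint action of a
nilpotent group is unipotent, so squaring is open; together with the algebra of nilpotent groups this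
makes it a quotient covering of `N` by `N`, and a homeomorphism because `N` is simply connected
(`exists_isSquareRoot`). Its inverse `r` commutes with automorphisms, and its iterates contract
compact sets to `1` (`IsSquareRoot.exists_forall_iterate_mem`). Each of the three facts is thereby
reduced to a neighbourhood of `1`, where it follows from the inverse function theorem, or from
expansion by the differential.
-/

/-! ### Differentiation at the identity -/

section DerivAtOne

open Filter Topology

variable {E : Type*} [NormedAddCommGroup E] [NormedSpace ℝ E]
  {N : Type*} [TopologicalSpace N] [ChartedSpace E N] [Group N]

/-- The preferred chart of `N` at the identity, as a map to the model space. -/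
noncomputable def chartAtOne (E N : Type*) [NormedAddCommGroup E] [NormedSpace ℝ E]
    [TopologicalSpace N] [ChartedSpace E N] [Group N] : PartialEquiv N E :=
  extChartAt 𝓘(ℝ, E) (1 : N)

/-- `f : N → N` fixes the identity, is continuous there, and, read in the chart at the identity,
has strict derivative `D` there. -/
structure HasDerivAtOne (f : N → N) (D : E →L[ℝ] E) : Prop where
  map_one : f 1 = 1
  continuousAt : ContinuousAt f 1
  hasStrictFDerivAt : HasStrictFDerivAt
    (fun u => chartAtOne E N (f ((chartAtOne E N).symm u))) D (chartAtOne E N 1)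

theorem chartAtOne_symm_one : (chartAtOne E N).symm (chartAtOne E N 1) = 1 :=
  extChartAt_to_inv (I := 𝓘(ℝ, E)) (1 : N)

theorem chartAtOne_source_mem_nhds : (chartAtOne E N).source ∈ 𝓝 (1 : N) :=
  extChartAt_source_mem_nhds (I := 𝓘(ℝ, E)) (1 : N)

theorem chartAtOne_target_mem_nhds : (chartAtOne E N).target ∈ 𝓝 (chartAtOne E N 1) :=
  extChartAt_target_mem_nhds (I := 𝓘(ℝ, E)) (1 : N)

theorem continuousOn_chartAtOne_symm :
    ContinuousOn (chartAtOne E N).symm (chartAtOne E N).target :=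
  continuousOn_extChartAt_symm (I := 𝓘(ℝ, E)) (1 : N)

theorem continuousAt_chartAtOne : ContinuousAt (chartAtOne E N) (1 : N) :=
  continuousAt_extChartAt (I := 𝓘(ℝ, E)) (1 : N)

theorem tendsto_chartAtOne_symm :
    Tendsto (chartAtOne E N).symm (𝓝 (chartAtOne E N 1)) (𝓝 1) := by
  have h := continuousAt_extChartAt_symm (I := 𝓘(ℝ, E)) (1 : N)
  have h1 : (chartAtOne E N).symm (chartAtOne E N 1) = 1 := chartAtOne_symm_one
  unfold ContinuousAt at h
  rw [show (extChartAt 𝓘(ℝ, E) (1 : N)) = chartAtOne E N from rfl, h1] at h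
  exact h

theorem map_chartAtOne_nhds :
    map (chartAtOne E N) (𝓝 (1 : N)) = 𝓝 (chartAtOne E N 1) :=
  map_extChartAt_nhds_of_boundaryless (I := 𝓘(ℝ, E)) (1 : N)

theorem map_chartAtOne_symm_nhds :
    map (chartAtOne E N).symm (𝓝 (chartAtOne E N 1)) = 𝓝 (1 : N) := by
  rw [← map_chartAtOne_nhds, Filter.map_map]
  refine (map_congr ?_).trans map_id
  filter_upwards [chartAtOne_source_mem_nhds (E := E) (N := N)] with x hx
  exact (chartAtOne E N).left_inv hx

theorem contDiffAt_chartAtOne [IsManifold 𝓘(ℝ, E) ∞ N] {F : Type*} [NormedAddCommGroup F]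
    [NormedSpace ℝ F] {f : F → N} {u : F} (hf : ContMDiffAt 𝓘(ℝ, F) 𝓘(ℝ, E) ∞ f u)
    (hu : f u = 1) : ContDiffAt ℝ ∞ (fun w => chartAtOne E N (f w)) u := by
  rw [← contMDiffAt_iff_contDiffAt]
  refine ContMDiffAt.comp u (I' := 𝓘(ℝ, E)) (g := chartAtOne E N) ?_ hf
  rw [hu]
  exact contMDiffAt_extChartAt

theorem contMDiffAt_chartAtOne_symm [IsManifold 𝓘(ℝ, E) ∞ N] :
    ContMDiffAt 𝓘(ℝ, E) 𝓘(ℝ, E) ∞ (chartAtOne E N).symm (chartAtOne E N 1) :=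
  (contMDiffOn_extChartAt_symm (1 : N)).contMDiffAt (extChartAt_target_mem_nhds (1 : N))

theorem contDiffAt_writtenAtOne [IsManifold 𝓘(ℝ, E) ∞ N] {f : N → N}
    (hf : ContMDiff 𝓘(ℝ, E) 𝓘(ℝ, E) ∞ f) (h1 : f 1 = 1) :
    ContDiffAt ℝ ∞ (fun u => chartAtOne E N (f ((chartAtOne E N).symm u)))
      (chartAtOne E N 1) := by
  refine contDiffAt_chartAtOne (f := fun u => f ((chartAtOne E N).symm u))
    (hf.contMDiffAt.comp _ contMDiffAt_chartAtOne_symm) ?_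
  simp only [chartAtOne_symm_one, h1]

theorem ContMDiff.hasDerivAtOne [IsManifold 𝓘(ℝ, E) ∞ N] {f : N → N}
    (hf : ContMDiff 𝓘(ℝ, E) 𝓘(ℝ, E) ∞ f) (h1 : f 1 = 1) :
    ∃ D : E →L[ℝ] E, D.toLinearMap = differentialAtOne f ∧ HasDerivAtOne f D := by
  refine ⟨mfderiv 𝓘(ℝ, E) 𝓘(ℝ, E) f (1 : N), rfl, h1, hf.continuous.continuousAt, ?_⟩
  have hc := (contDiffAt_writtenAtOne hf h1).hasStrictFDerivAt (by simp)
  have hm : HasMFDerivAt 𝓘(ℝ, E) 𝓘(ℝ, E) f 1 (mfderiv 𝓘(ℝ, E) 𝓘(ℝ, E) f (1 : N)) :=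
    (hf.mdifferentiable (by simp) 1).hasMFDerivAt
  have h2 := hm.2
  simp only [modelWithCornersSelf_coe, Set.range_id] at h2
  have h3 : writtenInExtChartAt 𝓘(ℝ, E) 𝓘(ℝ, E) 1 f
      = fun u => chartAtOne E N (f ((chartAtOne E N).symm u)) := by
    funext u
    simp only [writtenInExtChartAt, chartAtOne, h1, Function.comp]
  rw [h3] at h2
  let D : E →L[ℝ] E := mfderiv 𝓘(ℝ, E) 𝓘(ℝ, E) f (1 : N)
  have h4 : HasFDerivAt (fun u => chartAtOne E N (f ((chartAtOne E N).symm u))) D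
      (chartAtOne E N 1) := hasFDerivWithinAt_univ.1 h2
  have h5 : D = _ := h4.unique hc.hasFDerivAt
  change HasStrictFDerivAt _ D _
  rw [h5]
  exact hc

namespace HasDerivAtOne

variable {f g : N → N} {D D' : E →L[ℝ] E}

theorem tendsto (hf : HasDerivAtOne f D) : Tendsto f (𝓝 1) (𝓝 1) := by
  have := hf.continuousAt
  rwa [ContinuousAt, hf.map_one] at this

protected theorem id : HasDerivAtOne (id : N → N) (ContinuousLinearMap.id ℝ E) := by
  refine ⟨rfl, continuousAt_id, (hasStrictFDerivAt_id _).congr_of_eventuallyEq ?_⟩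
  filter_upwards [extChartAt_target_mem_nhds (I := 𝓘(ℝ, E)) (1 : N)] with u hu
  exact ((chartAtOne E N).right_inv hu).symm

protected theorem const_one : HasDerivAtOne (fun _ => 1 : N → N) (0 : E →L[ℝ] E) :=
  ⟨rfl, continuousAt_const, hasStrictFDerivAt_const _ _⟩

theorem unique (hf : HasDerivAtOne f D) (hf' : HasDerivAtOne f D') : D = D' :=
  hf.hasStrictFDerivAt.hasFDerivAt.unique hf'.hasStrictFDerivAt.hasFDerivAt

theorem comp (hg : HasDerivAtOne g D') (hf : HasDerivAtOne f D) :
    HasDerivAtOne (g ∘ f) (D' ∘L D) := by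
  refine ⟨by simp [hf.map_one, hg.map_one], ?_, ?_⟩
  · refine ContinuousAt.comp ?_ hf.continuousAt
    rw [hf.map_one]; exact hg.continuousAt
  · have h1 := hg.hasStrictFDerivAt
    have hp : (fun u => chartAtOne E N (f ((chartAtOne E N).symm u))) (chartAtOne E N 1)
        = chartAtOne E N 1 := by simp only [chartAtOne_symm_one, hf.map_one]
    rw [← hp] at h1
    refine (HasStrictFDerivAt.comp (chartAtOne E N 1) h1 hf.hasStrictFDerivAt).congr_of_eventuallyEq ?_
    have h2 := (hf.tendsto.comp (tendsto_chartAtOne_symm (E := E))).eventually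
      (chartAtOne_source_mem_nhds (E := E) (N := N))
    filter_upwards [h2] with u hu
    simp only [Function.comp] at hu ⊢
    rw [(chartAtOne E N).left_inv hu]

theorem mul [LieGroup 𝓘(ℝ, E) ∞ N] (hf : HasDerivAtOne f D) (hg : HasDerivAtOne g D') :
    HasDerivAtOne (fun x => f x * g x) (D + D') := by
  have := topologicalGroup_of_lieGroup 𝓘(ℝ, E) ∞ (G := N)
  refine ⟨by simp [hf.map_one, hg.map_one], hf.continuousAt.mul hg.continuousAt, ?_⟩
  set φ := chartAtOne E N with hφ
  -- the multiplication in the chart, and its differential at the base point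
  let m : E × E → E := fun p => φ (φ.symm p.1 * φ.symm p.2)
  have hm : ContDiffAt ℝ ∞ m (φ 1, φ 1) := by
    refine contDiffAt_chartAtOne (f := fun p : E × E => φ.symm p.1 * φ.symm p.2) ?_ ?_
    · refine ContMDiffAt.mul (I := 𝓘(ℝ, E)) (n := ∞) (f := fun p : E × E => φ.symm p.1)
        (g := fun p : E × E => φ.symm p.2) ?_ ?_
      · exact ContMDiffAt.comp (φ 1, φ 1) (g := φ.symm) (I' := 𝓘(ℝ, E))
          contMDiffAt_chartAtOne_symm contDiff_fst.contMDiff.contMDiffAt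
      · exact ContMDiffAt.comp (φ 1, φ 1) (g := φ.symm) (I' := 𝓘(ℝ, E))
          contMDiffAt_chartAtOne_symm contDiff_snd.contMDiff.contMDiffAt
    · simp [hφ, chartAtOne_symm_one]
  have hs := hm.hasStrictFDerivAt (by simp)
  set M := fderiv ℝ m (φ 1, φ 1)
  have hid := (HasDerivAtOne.id (E := E) (N := N)).hasStrictFDerivAt
  have hleft : M.comp (ContinuousLinearMap.inl ℝ E E) = ContinuousLinearMap.id ℝ E := by
    have h1 : HasStrictFDerivAt (fun u : E => (u, φ 1)) (ContinuousLinearMap.inl ℝ E E) (φ 1) :=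
      (hasStrictFDerivAt_id _).prodMk (hasStrictFDerivAt_const _ _)
    have h2 := HasStrictFDerivAt.comp (f := fun u : E => (u, φ 1)) (φ 1) hs h1
    refine h2.hasFDerivAt.unique (hid.hasFDerivAt.congr_of_eventuallyEq ?_)
    exact .of_forall fun u => by simp [m, hφ, chartAtOne_symm_one]
  have hright : M.comp (ContinuousLinearMap.inr ℝ E E) = ContinuousLinearMap.id ℝ E := by
    have h1 : HasStrictFDerivAt (fun u : E => (φ 1, u)) (ContinuousLinearMap.inr ℝ E E) (φ 1) :=
      (hasStrictFDerivAt_const _ _).prodMk (hasStrictFDerivAt_id _)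
    have h2 := HasStrictFDerivAt.comp (f := fun u : E => (φ 1, u)) (φ 1) hs h1
    refine h2.hasFDerivAt.unique (hid.hasFDerivAt.congr_of_eventuallyEq ?_)
    exact .of_forall fun u => by simp [m, hφ, chartAtOne_symm_one]
  have hp : HasStrictFDerivAt (fun u => (φ (f (φ.symm u)), φ (g (φ.symm u)))) (D.prod D') (φ 1) :=
    hf.hasStrictFDerivAt.prodMk hg.hasStrictFDerivAt
  have hs' : HasStrictFDerivAt m M
      ((fun u => (φ (f (φ.symm u)), φ (g (φ.symm u)))) (φ 1)) := by
    simpa [hφ, chartAtOne_symm_one, hf.map_one, hg.map_one] using hs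
  have hfin := hs'.comp (φ 1) hp
  have hD : M.comp (D.prod D') = D + D' := by
    ext v
    have e1 := congrArg (fun A => A (D v)) hleft
    have e2 := congrArg (fun A => A (D' v)) hright
    simp only [ContinuousLinearMap.comp_apply, ContinuousLinearMap.inl_apply,
      ContinuousLinearMap.inr_apply, ContinuousLinearMap.id_apply] at e1 e2
    rw [ContinuousLinearMap.comp_apply, ContinuousLinearMap.prod_apply,
      show ((D v, D' v) : E × E) = (D v, 0) + (0, D' v) by simp, map_add, e1, e2]
    rfl
  rw [hD] at hfin
  refine hfin.congr_of_eventuallyEq ?_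
  filter_upwards [(hf.tendsto.comp (tendsto_chartAtOne_symm (E := E))).eventually
      (chartAtOne_source_mem_nhds (E := E) (N := N)),
    (hg.tendsto.comp (tendsto_chartAtOne_symm (E := E))).eventually
      (chartAtOne_source_mem_nhds (E := E) (N := N))] with u hu hu'
  simp only [Function.comp] at hu hu' ⊢
  simp only [m]
  rw [φ.left_inv hu, φ.left_inv hu']

theorem inv [LieGroup 𝓘(ℝ, E) ∞ N] (hf : HasDerivAtOne f D) :
    HasDerivAtOne (fun x => (f x)⁻¹) (-D) := by
  have hsm : ContMDiff 𝓘(ℝ, E) 𝓘(ℝ, E) ∞ (fun x : N => x⁻¹) := contMDiff_inv _ _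
  obtain ⟨J, -, hJ⟩ := hsm.hasDerivAtOne inv_one
  have h0 : HasDerivAtOne (fun x : N => x * x⁻¹) (ContinuousLinearMap.id ℝ E + J) :=
    HasDerivAtOne.id.mul hJ
  simp only [mul_inv_cancel] at h0
  have h1 : J = -ContinuousLinearMap.id ℝ E := by
    rw [eq_neg_iff_add_eq_zero, add_comm]; exact h0.unique HasDerivAtOne.const_one
  have := hJ.comp hf
  rw [h1] at this
  simpa [Function.comp_def] using this

/-- A map with invertible differential at the identity is open there. -/
theorem map_nhds_one [CompleteSpace E] (hf : HasDerivAtOne f D) (hD : D.range = ⊤) :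
    map f (𝓝 1) = 𝓝 1 := by
  have h := hf.hasStrictFDerivAt.map_nhds_eq_of_surj hD
  simp only [chartAtOne_symm_one, hf.map_one] at h
  have h1 : map (fun x => (chartAtOne E N).symm (chartAtOne E N (f x))) (𝓝 (1 : N)) = 𝓝 1 := by
    conv_rhs => rw [← map_chartAtOne_symm_nhds (E := E), ← h]
    conv_lhs => rw [← map_chartAtOne_symm_nhds (E := E)]
    rfl
  refine Eq.trans (Filter.map_congr ?_) h1
  filter_upwards [hf.tendsto.eventually (chartAtOne_source_mem_nhds (E := E) (N := N))] with x hx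
  exact ((chartAtOne E N).left_inv hx).symm

/-- First-order expansion at the identity, in the chart centred at the identity. -/
theorem isLittleO (hf : HasDerivAtOne f D) :
    (fun x => chartAtOne E N (f x) - chartAtOne E N 1 - D (chartAtOne E N x - chartAtOne E N 1))
      =o[𝓝 1] fun x => chartAtOne E N x - chartAtOne E N 1 := by
  have h := hf.hasStrictFDerivAt.hasFDerivAt.isLittleO.comp_tendsto
    (continuousAt_chartAtOne (E := E) (N := N))
  refine h.congr' ?_ .rfl
  filter_upwards [chartAtOne_source_mem_nhds (E := E) (N := N)] with x hx
  simp only [Function.comp, (chartAtOne E N).left_inv hx, chartAtOne_symm_one, hf.map_one]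

end HasDerivAtOne

end DerivAtOne

/-! ### Square roots in nilpotent groups -/

section NilpotentAlgebra

open Subgroup
open scoped commutatorElement

universe u

/-- If all commutators with `a` are central, then `⁅a, ·⁆` is a homomorphism. -/
def commutatorHom {G : Type*} [Group G] (a : G) (ha : ∀ b, ⁅a, b⁆ ∈ center G) : G →* G where
  toFun b := ⁅a, b⁆
  map_one' := commutatorElement_one_right a
  map_mul' b c := by
    have h := mem_center_iff.1 (ha c) b
    calc ⁅a, b * c⁆ = ⁅a, b⁆ * (b * ⁅a, c⁆ * b⁻¹) := by simp only [commutatorElement_def]; group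
      _ = ⁅a, b⁆ * ⁅a, c⁆ := by rw [h]; group

@[simp] theorem commutatorHom_apply {G : Type*} [Group G] (a : G)
    (ha : ∀ b, ⁅a, b⁆ ∈ center G) (b : G) : commutatorHom a ha b = ⁅a, b⁆ := rfl

theorem commutator_mul_self_left {G : Type*} [Group G] {a : G} (ha : ∀ b, ⁅a, b⁆ ∈ center G)
    (b : G) : ⁅a * a, b⁆ = ⁅a, b⁆ * ⁅a, b⁆ := by
  have h := mem_center_iff.1 (ha b) a
  calc ⁅a * a, b⁆ = (a * ⁅a, b⁆ * a⁻¹) * ⁅a, b⁆ := by simp only [commutatorElement_def]; group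
    _ = ⁅a, b⁆ * ⁅a, b⁆ := by rw [h]; group

theorem lowerCentralSeries_le_of_commutator_mem {G : Type*} [Group G] {K : Subgroup G} {n : ℕ}
    (hn : (⊤ : Subgroup G).lowerCentralSeries (n + 2) = ⊥)
    (hK : ∀ a : G, (∀ b, ⁅a, b⁆ ∈ center G) → ∀ b, ⁅a, b⁆ ∈ K) :
    (⊤ : Subgroup G).lowerCentralSeries (n + 1) ≤ K := by
  rw [Subgroup.lowerCentralSeries_succ, commutator_le]
  intro a ha b _
  refine hK a (fun b => mem_center_iff.2 fun g => ?_) b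
  have h : ⁅⁅a, b⁆, g⁆ ∈ (⊤ : Subgroup G).lowerCentralSeries (n + 2) :=
    commutator_mem_commutator (commutator_mem_commutator ha (mem_top b)) (mem_top g)
  rw [hn, mem_bot] at h
  exact (commutatorElement_eq_one_iff_mul_comm.1 h).symm

theorem lowerCentralSeries_quotient_eq_bot {G : Type*} [Group G] {K : Subgroup G} [K.Normal]
    {n : ℕ} (h : (⊤ : Subgroup G).lowerCentralSeries n ≤ K) :
    (⊤ : Subgroup (G ⧸ K)).lowerCentralSeries n = ⊥ := by
  have h1 := Subgroup.map_lowerCentralSeries (⊤ : Subgroup G) (QuotientGroup.mk' K) n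
  rw [Subgroup.map_top_of_surjective _ (QuotientGroup.mk'_surjective K)] at h1
  rw [← h1, Subgroup.map_eq_bot_iff, QuotientGroup.ker_mk']
  exact h

theorem mul_comm_of_lowerCentralSeries_one {G : Type*} [Group G]
    (h : (⊤ : Subgroup G).lowerCentralSeries 1 = ⊥) (a b : G) : a * b = b * a := by
  have h1 : ⁅a, b⁆ ∈ (⊤ : Subgroup G).lowerCentralSeries 1 :=
    commutator_mem_commutator (mem_top a) (mem_top b)
  rw [h, mem_bot] at h1
  exact commutatorElement_eq_one_iff_mul_comm.1 h1

/-- A nilpotent group generated by squares consists of squares. The last nontrivial term of the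
lower central series is generated by values of homomorphisms from `G` to its center, hence consists
of squares of central elements, and induction applies to the quotient. -/
theorem exists_mul_self_eq_of_closure (n : ℕ) : ∀ (G : Type u) [Group G],
    (⊤ : Subgroup G).lowerCentralSeries (n + 1) = ⊥ →
    closure (Set.range fun x : G => x * x) = ⊤ → ∀ g : G, ∃ x, x * x = g := by
  induction n with
  | zero =>
    intro G _ hG hsq g
    have hg : g ∈ closure (Set.range fun x : G => x * x) := hsq ▸ mem_top g
    have hc := mul_comm_of_lowerCentralSeries_one hG
    induction hg using closure_induction with
    | mem x hx => exact hx
    | one => exact ⟨1, one_mul 1⟩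
    | mul x y _ _ hx hy =>
      obtain ⟨a, rfl⟩ := hx
      obtain ⟨b, rfl⟩ := hy
      exact ⟨a * b, by rw [mul_assoc, ← mul_assoc b, hc b a]; group⟩
    | inv x _ hx =>
      obtain ⟨a, rfl⟩ := hx
      exact ⟨a⁻¹, by group⟩
  | succ n ih =>
    intro G _ hG hsq g
    let K : Subgroup G :=
      { carrier := {z | ∃ w ∈ center G, w * w = z}
        one_mem' := ⟨1, one_mem _, one_mul 1⟩
        mul_mem' := by
          rintro _ _ ⟨a, ha, rfl⟩ ⟨b, hb, rfl⟩
          refine ⟨a * b, mul_mem ha hb, ?_⟩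
          have := mem_center_iff.1 ha b
          rw [mul_assoc, ← mul_assoc b, this]; group
        inv_mem' := by
          rintro _ ⟨a, ha, rfl⟩
          exact ⟨a⁻¹, inv_mem ha, by group⟩ }
    have hKc : K ≤ center G := by
      rintro _ ⟨a, ha, rfl⟩
      exact mul_mem ha ha
    have : K.Normal := ⟨fun z hz g => by
      rw [mem_center_iff.1 (hKc hz) g]; simpa using hz⟩
    have hK : (⊤ : Subgroup G).lowerCentralSeries (n + 1) ≤ K := by
      refine lowerCentralSeries_le_of_commutator_mem hG fun a ha b => ?_
      have hle : closure (Set.range fun x : G => x * x) ≤ K.comap (commutatorHom a ha) := by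
        rw [closure_le]
        rintro _ ⟨x, rfl⟩
        exact ⟨⁅a, x⁆, ha x, (map_mul (commutatorHom a ha) x x).symm⟩
      rw [hsq] at hle
      exact hle (mem_top b)
    have hq : closure (Set.range fun x : G ⧸ K => x * x) = ⊤ := by
      have h1 := congrArg (Subgroup.map (QuotientGroup.mk' K)) hsq
      rw [Subgroup.map_top_of_surjective _ (QuotientGroup.mk'_surjective K),
        MonoidHom.map_closure] at h1
      rw [eq_top_iff, ← h1, closure_le]
      rintro _ ⟨_, ⟨x, rfl⟩, rfl⟩
      exact subset_closure ⟨x, rfl⟩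
    obtain ⟨x, hx⟩ := ih (G ⧸ K) (lowerCentralSeries_quotient_eq_bot hK) hq g
    obtain ⟨x, rfl⟩ := QuotientGroup.mk_surjective x
    rw [← QuotientGroup.mk_mul, QuotientGroup.eq] at hx
    obtain ⟨w, hw, hxw⟩ := hx
    refine ⟨x * w, ?_⟩
    have := mem_center_iff.1 hw x
    rw [mul_assoc, ← mul_assoc w, ← this, mul_assoc x w w, hxw]; group

/-- In a nilpotent group in which all elements are squares, two square roots of an element differ
by a central involution. -/
theorem exists_center_of_mul_self_eq (G : Type u) [Group G] [Group.IsNilpotent G]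
    (hG : ∀ g : G, ∃ x, x * x = g) {x y : G} (hxy : x * x = y * y) :
    ∃ z ∈ center G, z * z = 1 ∧ y = x * z := by
  refine Group.nilpotent_center_quotient_ind (P := fun G _ _ => (∀ g : G, ∃ x, x * x = g) →
    ∀ x y : G, x * x = y * y → ∃ z ∈ center G, z * z = 1 ∧ y = x * z) G ?_ ?_ hG x y hxy
  · exact fun G _ _ _ x y _ => ⟨1, one_mem _, one_mul 1, Subsingleton.elim _ _⟩
  · intro G _ _ ih hG x y hxy
    have hq : ∀ g : G ⧸ center G, ∃ x, x * x = g := by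
      intro g
      obtain ⟨g, rfl⟩ := QuotientGroup.mk_surjective g
      obtain ⟨x, rfl⟩ := hG g
      exact ⟨x, rfl⟩
    obtain ⟨w, hwc, hww, hw⟩ := ih hq x y
      (by rw [← QuotientGroup.mk_mul, hxy, QuotientGroup.mk_mul])
    obtain ⟨w, rfl⟩ := QuotientGroup.mk_surjective w
    -- `v = x⁻¹ y` lies in the second center and its square is central
    set v := x⁻¹ * y with hv
    have hvw : (v : G ⧸ center G) = w := by
      rw [hv, QuotientGroup.mk_mul, hw, QuotientGroup.mk_inv]; group
    have hvc : ∀ b, ⁅v, b⁆ ∈ center G := by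
      intro b
      rw [← QuotientGroup.eq_one_iff]
      change QuotientGroup.mk' (center G) ⁅v, b⁆ = 1
      rw [map_commutatorElement, commutatorElement_eq_one_iff_mul_comm]
      have := mem_center_iff.1 hwc b
      rw [← hvw] at this
      exact this.symm
    have hvv : v * v ∈ center G := by
      rw [← QuotientGroup.eq_one_iff, QuotientGroup.mk_mul, hvw, hww]
    have hvz : v ∈ center G := by
      refine mem_center_iff.2 fun b => ?_
      obtain ⟨c, rfl⟩ := hG b
      have h1 : ⁅v, c * c⁆ = 1 := by
        rw [← commutatorHom_apply v hvc, map_mul, commutatorHom_apply,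
          ← commutator_mul_self_left hvc, commutatorElement_eq_one_iff_mul_comm]
        exact (mem_center_iff.1 hvv c).symm
      exact (commutatorElement_eq_one_iff_mul_comm.1 h1).symm
    have hy : y = x * v := by rw [hv]; group
    refine ⟨v, hvz, ?_, hy⟩
    have h2 : x * x = x * x * (v * v) := by
      conv_lhs => rw [hxy, hy]
      have := mem_center_iff.1 hvz x
      rw [mul_assoc, ← mul_assoc v, ← this]; group
    exact (left_eq_mul.1 h2)

end NilpotentAlgebra

/-! ### The adjoint action and the squaring map -/

section Adjoint

open Filter Topology
open scoped commutatorElement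

variable {E : Type*} [NormedAddCommGroup E] [NormedSpace ℝ E]
  {N : Type*} [TopologicalSpace N] [ChartedSpace E N] [Group N] [LieGroup 𝓘(ℝ, E) ∞ N]

theorem exists_hasDerivAtOne_conj (g : N) :
    ∃ D : E →L[ℝ] E, HasDerivAtOne (fun x : N => g * x * g⁻¹) D := by
  have hsm : ContMDiff 𝓘(ℝ, E) 𝓘(ℝ, E) ∞ (fun x : N => g * x * g⁻¹) :=
    (contMDiff_const.mul contMDiff_id).mul contMDiff_const
  obtain ⟨D, -, hD⟩ := hsm.hasDerivAtOne (by simp)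
  exact ⟨D, hD⟩

/-- The adjoint action of `g`: the differential at the identity of conjugation by `g`. -/
noncomputable def adjointAction (E : Type*) [NormedAddCommGroup E] [NormedSpace ℝ E]
    {N : Type*} [TopologicalSpace N] [ChartedSpace E N] [Group N] [LieGroup 𝓘(ℝ, E) ∞ N]
    (g : N) : E →L[ℝ] E :=
  (exists_hasDerivAtOne_conj g).choose

theorem hasDerivAtOne_conj (g : N) :
    HasDerivAtOne (fun x : N => g * x * g⁻¹) (adjointAction E g) :=
  (exists_hasDerivAtOne_conj g).choose_spec

theorem adjointAction_comm {A : MulAut N} {D : E →L[ℝ] E} (hA : HasDerivAtOne A D) (g : N) :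
    D * adjointAction E g = adjointAction E (A g) * D := by
  have h1 := hA.comp (hasDerivAtOne_conj g)
  have h2 := (hasDerivAtOne_conj (E := E) (A g)).comp hA
  refine h1.unique (D := D * adjointAction E g) (D' := adjointAction E (A g) * D) ?_
  have h3 : A ∘ (fun x => g * x * g⁻¹) = (fun x => A g * x * (A g)⁻¹) ∘ A := by
    funext x; simp
  rw [h3]
  exact h2

/-- Products of sufficiently many operators `Ad g - 1` vanish, being the differential of an iterated
commutator map, which is trivial on a nilpotent group. -/
theorem exists_prod_adjointAction_sub_one_eq_zero [Group.IsNilpotent N] :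
    ∃ c : ℕ, ∀ l : List N, l.length = c →
      (l.map fun g => adjointAction E g - 1).prod = 0 := by
  obtain ⟨c, hc⟩ := (Subgroup.nilpotent_iff_lowerCentralSeries (G := N)).1 inferInstance
  refine ⟨c, fun l hl => ?_⟩
  have key : ∀ l : List N, ∃ f : N → N,
      HasDerivAtOne f ((l.map fun g => adjointAction E g - 1).prod) ∧
      ∀ y, f y ∈ (⊤ : Subgroup N).lowerCentralSeries l.length := by
    intro l
    induction l with
    | nil => exact ⟨id, HasDerivAtOne.id, fun y => Subgroup.mem_top y⟩
    | cons g l ih =>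
      obtain ⟨f, hf, hfl⟩ := ih
      refine ⟨fun y => g * f y * g⁻¹ * (f y)⁻¹, ?_, fun y => ?_⟩
      · have := ((hasDerivAtOne_conj (E := E) g).comp hf).mul hf.inv
        rw [List.map_cons, List.prod_cons, sub_mul, one_mul, sub_eq_add_neg]
        exact this
      · have h1 : ⁅f y, g⁆⁻¹ ∈ (⊤ : Subgroup N).lowerCentralSeries (g :: l).length :=
          inv_mem (Subgroup.commutator_mem_commutator (hfl y) (Subgroup.mem_top g))
        rwa [commutatorElement_inv] at h1
  obtain ⟨f, hf, hfl⟩ := key l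
  rw [hl, hc] at hfl
  have : f = fun _ => 1 := funext fun y => Subgroup.mem_bot.1 (hfl y)
  rw [this] at hf
  exact hf.unique HasDerivAtOne.const_one

theorem injective_adjointAction_add_one [Group.IsNilpotent N] (g : N) :
    Function.Injective (adjointAction E g + 1 : E →L[ℝ] E) := by
  obtain ⟨c, hc⟩ := exists_prod_adjointAction_sub_one_eq_zero (E := E) (N := N)
  rw [injective_iff_map_eq_zero]
  intro v hv
  have h1 : (adjointAction E g - 1) v = (-2 : ℝ) • v := by
    have h2 : adjointAction E g v = -v := eq_neg_of_add_eq_zero_left hv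
    rw [sub_apply, h2, one_apply_eq_self, neg_smul, two_smul]
    abel
  have h2 : ∀ n : ℕ, ((adjointAction E g - 1) ^ n) v = (-2 : ℝ) ^ n • v := by
    intro n
    induction n with
    | zero => simp
    | succ n ih =>
      rw [pow_succ, mul_apply_eq_comp, h1, map_smul, ih, smul_smul, pow_succ, mul_comm]
  have h3 := hc (List.replicate c g) (List.length_replicate ..)
  rw [List.map_replicate, List.prod_replicate] at h3
  have h4 := h2 c
  rw [h3, zero_apply] at h4
  exact (smul_eq_zero.1 h4.symm).resolve_left (pow_ne_zero _ (by norm_num))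

/-- The squaring map is open: at `g` its left-trivialized differential is `Ad g⁻¹ + 1`. -/
theorem isOpenMap_mul_self (E : Type*) [NormedAddCommGroup E] [NormedSpace ℝ E]
    [FiniteDimensional ℝ E] {N : Type*} [TopologicalSpace N] [ChartedSpace E N] [Group N]
    [LieGroup 𝓘(ℝ, E) ∞ N] [Group.IsNilpotent N] : IsOpenMap fun x : N => x * x := by
  have := topologicalGroup_of_lieGroup 𝓘(ℝ, E) ∞ (G := N)
  have := FiniteDimensional.complete ℝ E
  rw [isOpenMap_iff_nhds_le]
  intro g
  have h1 := (hasDerivAtOne_conj (E := E) g⁻¹).mul HasDerivAtOne.id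
  have h2 := h1.map_nhds_one (LinearMap.range_eq_top.2
    (LinearMap.surjective_of_injective (injective_adjointAction_add_one g⁻¹)))
  have h3 : (fun x : N => x * x) ∘ (fun y => g * y)
      = (fun y => (g * g) * y) ∘ fun x => g⁻¹ * x * g⁻¹⁻¹ * id x := by
    funext y; simp only [Function.comp, id]; group
  have h4 : ∀ a : N, map (fun y => a * y) (𝓝 1) = 𝓝 a := fun a => by
    rw [map_mul_left_nhds, mul_one]
  rw [← h4 g, Filter.map_map, h3, ← Filter.map_map, h2, h4]

/-- Squaring expands the chart centred at the identity by a factor close to `2`. -/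
theorem eventually_le_norm_mul_self : ∀ᶠ x in 𝓝 (1 : N),
    3 / 2 * ‖chartAtOne E N x - chartAtOne E N 1‖
      ≤ ‖chartAtOne E N (x * x) - chartAtOne E N 1‖ := by
  have h1 := ((HasDerivAtOne.id (E := E) (N := N)).mul HasDerivAtOne.id).isLittleO
  filter_upwards [h1.bound (c := 1 / 2) (by norm_num)] with x hx
  simp only [id, add_apply, ContinuousLinearMap.id_apply] at hx
  set a := chartAtOne E N x - chartAtOne E N 1
  set b := chartAtOne E N (x * x) - chartAtOne E N 1
  have h2 : ‖a + a‖ ≤ ‖b‖ + ‖b - (a + a)‖ := by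
    calc ‖a + a‖ = ‖b - (b - (a + a))‖ := by congr 1; abel
      _ ≤ _ := norm_sub_le _ _
  have h3 : ‖a + a‖ = 2 * ‖a‖ := by rw [← two_smul ℝ a, norm_smul]; norm_num
  linarith

include E in
theorem eventually_eq_one_of_mul_self : ∀ᶠ x in 𝓝 (1 : N), x * x = 1 → x = 1 := by
  filter_upwards [eventually_le_norm_mul_self (E := E) (N := N),
    chartAtOne_source_mem_nhds (E := E) (N := N)] with x hx hxs h1
  rw [h1, sub_self, norm_zero] at hx
  have h2 : ‖chartAtOne E N x - chartAtOne E N 1‖ ≤ 0 := by linarith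
  rw [norm_le_zero_iff, sub_eq_zero] at h2
  exact (chartAtOne E N).injOn hxs (mem_of_mem_nhds chartAtOne_source_mem_nhds) h2

end Adjoint

section TopologicalGroup

open Filter Topology

theorem Subgroup.eq_top_of_mem_nhds_one {G : Type*} [Group G] [TopologicalSpace G]
    [IsTopologicalGroup G] [ConnectedSpace G] (K : Subgroup G) (hK : (K : Set G) ∈ 𝓝 1) :
    K = ⊤ := by
  have ho : IsOpen (K : Set G) := K.isOpen_of_mem_nhds hK
  have h := IsClopen.eq_univ ⟨K.isClosed_of_isOpen ho, ho⟩ ⟨1, K.one_mem⟩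
  rwa [Subgroup.coe_eq_univ] at h

end TopologicalGroup

/-! ### The square root -/

section SquareRoot

open Filter Topology
open scoped commutatorElement

/-- `r` is a continuous two-sided inverse of the squaring map. -/
structure IsSquareRoot {G : Type*} [Group G] [TopologicalSpace G] (r : G → G) : Prop where
  continuous : Continuous r
  mul_self : ∀ x, r x * r x = x
  apply_mul_self : ∀ x, r (x * x) = x

universe u

/-- In a simply connected nilpotent Lie group, squaring is a quotient covering map for the action of
the central involutions. Its base being simply connected, it is a homeomorphism. -/
theorem exists_isSquareRoot (E : Type*) [NormedAddCommGroup E] [NormedSpace ℝ E]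
    [FiniteDimensional ℝ E] (N : Type u) [TopologicalSpace N] [ChartedSpace E N] [Group N]
    [LieGroup 𝓘(ℝ, E) ∞ N] [SimplyConnectedSpace N] [Group.IsNilpotent N] :
    ∃ r : N → N, IsSquareRoot r := by
  have := topologicalGroup_of_lieGroup 𝓘(ℝ, E) ∞ (G := N)
  have : LocallyPathConnectedSpace N := ChartedSpace.locallyPathConnectedSpace E N
  have hopen := isOpenMap_mul_self E (N := N)
  have hcont : Continuous fun x : N => x * x := continuous_id.mul continuous_id
  have hsurj : ∀ g : N, ∃ x, x * x = g := by
    obtain ⟨n, hn⟩ := (Subgroup.nilpotent_iff_lowerCentralSeries (G := N)).1 inferInstance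
    refine exists_mul_self_eq_of_closure n N ?_ ?_
    · rw [eq_bot_iff, ← hn]
      exact Subgroup.lowerCentralSeries_antitone _ n.le_succ
    · refine Subgroup.eq_top_of_mem_nhds_one _ (mem_of_superset ?_ Subgroup.subset_closure)
      exact hopen.isOpen_range.mem_nhds ⟨1, one_mul 1⟩
  let μ : Subgroup N :=
    { carrier := {z | z ∈ Subgroup.center N ∧ z * z = 1}
      one_mem' := ⟨one_mem _, one_mul 1⟩
      mul_mem' := by
        rintro a b ⟨ha, ha'⟩ ⟨hb, hb'⟩
        refine ⟨mul_mem ha hb, ?_⟩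
        have := Subgroup.mem_center_iff.1 ha b
        rw [mul_assoc, ← mul_assoc b, this, mul_assoc a b b, hb', mul_one, ha']
      inv_mem' := by
        rintro a ⟨ha, ha'⟩
        exact ⟨inv_mem ha, by rw [← mul_inv_rev, ha', inv_one]⟩ }
  have hcov : IsQuotientCoveringMap (fun x : N => x * x) μ :=
    { toIsQuotientMap := hopen.isQuotientMap hcont hsurj
      continuous_const_smul := fun z => continuous_const.mul continuous_id
      apply_eq_iff_mem_orbit := by
        intro x y
        constructor
        · intro h
          obtain ⟨z, hz, hzz, hxy⟩ := exists_center_of_mul_self_eq N hsurj h.symm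
          refine ⟨⟨z, hz, hzz⟩, ?_⟩
          change z * y = x
          rw [hxy, Subgroup.mem_center_iff.1 hz y]
        · rintro ⟨⟨z, hz, hzz⟩, rfl⟩
          change z * y * (z * y) = y * y
          have := Subgroup.mem_center_iff.1 hz y
          rw [mul_assoc, ← mul_assoc y, this, mul_assoc z y y, ← mul_assoc z z, hzz, one_mul]
      disjoint := by
        intro e
        have hV := eventually_eq_one_of_mul_self (E := E) (N := N)
        have hc : ContinuousAt (fun p : N × N => p.1 * p.2⁻¹) (e, e) := by fun_prop
        have h1 : ∀ᶠ p in 𝓝 (e, e), p.1 * p.2⁻¹ * (p.1 * p.2⁻¹) = 1 → p.1 * p.2⁻¹ = (1 : N) := by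
          refine hc.eventually (p := fun x : N => x * x = 1 → x = 1) ?_
          simpa only [mul_inv_cancel] using hV
        rw [nhds_prod_eq] at h1
        obtain ⟨U, hU, h2⟩ := (Filter.eventually_prod_self_iff
          (r := fun x y : N => x * y⁻¹ * (x * y⁻¹) = 1 → x * y⁻¹ = 1)).1 h1
        refine ⟨U, hU, ?_⟩
        rintro ⟨z, hz, hzz⟩ ⟨_, ⟨x, hx, rfl⟩, hx'⟩
        change z * x ∈ U at hx'
        have h3 := h2 (z * x) hx' x hx
        simp only [mul_inv_cancel_right] at h3
        exact Subtype.ext (h3 hzz) }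
  obtain ⟨s, ⟨hs1, hs2⟩, -⟩ := hcov.isCoveringMap.existsUnique_continuousMap_lifts
    (ContinuousMap.id N) 1 1 (one_mul 1)
  have hs : ∀ x, s x * s x = x := fun x => congrFun hs2 x
  refine ⟨s, s.continuous, hs, fun x => ?_⟩
  refine congrFun (hcov.isCoveringMap.eq_of_comp_eq (g₁ := fun x => s (x * x)) (g₂ := id)
    (s.continuous.comp hcont) continuous_id ?_ 1 ?_) x
  · funext x; exact hs _
  · simp [hs1]

namespace IsSquareRoot

variable {G : Type*} [Group G] [TopologicalSpace G] {r : G → G}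

theorem map_apply (hr : IsSquareRoot r) (f : G →* G) (x : G) : r (f x) = f (r x) := by
  conv_lhs => rw [← hr.mul_self x, map_mul, hr.apply_mul_self]

theorem map_iterate_apply (hr : IsSquareRoot r) (f : G →* G) (k : ℕ) (x : G) :
    r^[k] (f x) = f (r^[k] x) := by
  induction k with
  | zero => rfl
  | succ k ih => rw [Function.iterate_succ_apply', ih, hr.map_apply, Function.iterate_succ_apply']

theorem apply_one (hr : IsSquareRoot r) : r 1 = 1 := by
  simpa using hr.apply_mul_self 1

theorem iterate_continuous (hr : IsSquareRoot r) (k : ℕ) : Continuous r^[k] :=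
  hr.continuous.iterate k

theorem apply_mem_center (hr : IsSquareRoot r) {z : G} (hz : z ∈ Subgroup.center G) :
    r z ∈ Subgroup.center G := by
  refine Subgroup.mem_center_iff.2 fun g => ?_
  have h := hr.map_apply (MulAut.conj g).toMonoidHom z
  simp only [MulEquiv.toMonoidHom_eq_coe, MonoidHom.coe_coe, MulAut.conj_apply] at h
  rw [Subgroup.mem_center_iff.1 hz g, mul_inv_cancel_right] at h
  conv_rhs => rw [h]
  group

theorem mul_of_mem_center (hr : IsSquareRoot r) (x : G) {z : G} (hz : z ∈ Subgroup.center G) :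
    r (x * z) = r x * r z := by
  have h : x * z = r x * r z * (r x * r z) := by
    have := Subgroup.mem_center_iff.1 (hr.apply_mem_center hz) (r x)
    conv_lhs => rw [← hr.mul_self x, ← hr.mul_self z]
    rw [mul_assoc, mul_assoc, ← mul_assoc (r z), ← this, mul_assoc (r x) (r z)]
  rw [h, hr.apply_mul_self]

theorem iterate_mul_of_mem_center (hr : IsSquareRoot r) (k : ℕ) (x : G) {z : G}
    (hz : z ∈ Subgroup.center G) :
    r^[k] z ∈ Subgroup.center G ∧ r^[k] (x * z) = r^[k] x * r^[k] z := by
  induction k with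
  | zero => exact ⟨hz, rfl⟩
  | succ k ih =>
    simp only [Function.iterate_succ_apply']
    exact ⟨hr.apply_mem_center ih.1, by rw [ih.2, hr.mul_of_mem_center _ ih.1]⟩

theorem iterate_pow (hr : IsSquareRoot r) (k : ℕ) (x : G) : r^[k] (x ^ 2 ^ k) = x := by
  induction k with
  | zero => simp
  | succ k ih =>
    rw [Function.iterate_succ_apply, pow_succ, mul_two, pow_add, hr.apply_mul_self, ih]

theorem pow_iterate (hr : IsSquareRoot r) (k : ℕ) (x : G) : r^[k] x ^ 2 ^ k = x := by
  induction k with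
  | zero => simp
  | succ k ih =>
    rw [Function.iterate_succ_apply', pow_succ', pow_mul, pow_two, hr.mul_self, ih]

end IsSquareRoot

/-- If the iterates of the square root tend to `1` near `1`, they do so everywhere. The induction
passes to the quotient by the central subgroup on which convergence holds: it contains the last
nontrivial term of the lower central series. -/
theorem tendsto_iterate_of_eventually (n : ℕ) : ∀ (G : Type u) [Group G] [TopologicalSpace G]
    [IsTopologicalGroup G] [ConnectedSpace G] (r : G → G), IsSquareRoot r →
    (∀ᶠ x in 𝓝 (1 : G), Tendsto (fun k => r^[k] x) atTop (𝓝 1)) →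
    (⊤ : Subgroup G).lowerCentralSeries (n + 1) = ⊥ →
    ∀ x, Tendsto (fun k => r^[k] x) atTop (𝓝 1) := by
  have hmul : ∀ (G : Type u) [Group G] [TopologicalSpace G] [IsTopologicalGroup G] (r : G → G),
      IsSquareRoot r → ∀ x z, z ∈ Subgroup.center G → Tendsto (fun k => r^[k] x) atTop (𝓝 1) →
      Tendsto (fun k => r^[k] z) atTop (𝓝 1) →
      Tendsto (fun k => r^[k] (x * z)) atTop (𝓝 1) := by
    intro G _ _ _ r hr x z hz hx hz'
    have := hx.mul hz'
    rw [one_mul] at this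
    exact this.congr fun k => (hr.iterate_mul_of_mem_center k x hz).2.symm
  have hinv : ∀ (G : Type u) [Group G] [TopologicalSpace G] [IsTopologicalGroup G] (r : G → G),
      IsSquareRoot r → ∀ z, z ∈ Subgroup.center G → Tendsto (fun k => r^[k] z) atTop (𝓝 1) →
      Tendsto (fun k => r^[k] z⁻¹) atTop (𝓝 1) := by
    intro G _ _ _ r hr z hz hz'
    have := hz'.inv
    rw [inv_one] at this
    refine this.congr fun k => ?_
    have h1 := (hr.iterate_mul_of_mem_center k z⁻¹ hz).2
    rw [inv_mul_cancel, Function.iterate_fixed hr.apply_one] at h1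
    exact (eq_inv_of_mul_eq_one_left h1.symm).symm
  have hone : ∀ (G : Type u) [Group G] [TopologicalSpace G] (r : G → G),
      IsSquareRoot r → Tendsto (fun k => r^[k] 1) atTop (𝓝 1) := by
    intro G _ _ r hr
    exact tendsto_const_nhds.congr fun k => (Function.iterate_fixed hr.apply_one k).symm
  -- the central subgroup on which the iterates converge
  have hsub : ∀ (G : Type u) [Group G] [TopologicalSpace G] [IsTopologicalGroup G] (r : G → G),
      IsSquareRoot r → ∃ K : Subgroup G, ∀ z, z ∈ K ↔
        z ∈ Subgroup.center G ∧ Tendsto (fun k => r^[k] z) atTop (𝓝 1) := by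
    intro G _ _ _ r hr
    exact ⟨{  carrier := {z | z ∈ Subgroup.center G ∧ Tendsto (fun k => r^[k] z) atTop (𝓝 1)}
              one_mem' := ⟨one_mem _, hone G r hr⟩
              mul_mem' := fun ha hb => ⟨mul_mem ha.1 hb.1, hmul G r hr _ _ hb.1 ha.2 hb.2⟩
              inv_mem' := fun ha => ⟨inv_mem ha.1, hinv G r hr _ ha.1 ha.2⟩ }, fun _ => Iff.rfl⟩
  induction n with
  | zero =>
    intro G _ _ _ _ r hr hB hG x
    obtain ⟨K, hK⟩ := hsub G r hr
    have hc : ∀ x : G, x ∈ Subgroup.center G := fun x =>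
      Subgroup.mem_center_iff.2 fun g => mul_comm_of_lowerCentralSeries_one hG g x
    have : K = ⊤ := K.eq_top_of_mem_nhds_one (by
      filter_upwards [hB] with x hx
      exact (hK x).2 ⟨hc x, hx⟩)
    exact ((hK x).1 (this ▸ Subgroup.mem_top x)).2
  | succ n ih =>
    intro G _ _ _ _ r hr hB hG x
    obtain ⟨K, hK⟩ := hsub G r hr
    have : K.Normal := ⟨fun z hz g => by
      rw [Subgroup.mem_center_iff.1 ((hK z).1 hz).1 g]; simpa using hz⟩
    have hle : (⊤ : Subgroup G).lowerCentralSeries (n + 1) ≤ K := by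
      refine lowerCentralSeries_le_of_commutator_mem hG fun a ha b => ?_
      have htop : K.comap (commutatorHom a ha) = ⊤ := by
        refine Subgroup.eq_top_of_mem_nhds_one _ ?_
        filter_upwards [hB] with b hb
        refine (hK _).2 ⟨ha b, ?_⟩
        have hc : Continuous fun b : G => ⁅a, b⁆ := by
          simp only [commutatorElement_def]; fun_prop
        have h1 := (hc.tendsto 1).comp hb
        rw [commutatorElement_one_right] at h1
        exact h1.congr fun k => (hr.map_iterate_apply (commutatorHom a ha) k b).symm
      exact (htop ▸ Subgroup.mem_top b : b ∈ K.comap (commutatorHom a ha))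
    have hrK : ∀ z ∈ K, r z ∈ K := fun z hz => by
      obtain ⟨h1, h2⟩ := (hK z).1 hz
      exact (hK _).2 ⟨hr.apply_mem_center h1, (h2.comp (tendsto_add_atTop_nat 1))⟩
    -- the induced square root on the quotient
    let q : G ⧸ K → G ⧸ K := Quotient.lift (fun x => ((r x : G) : G ⧸ K)) (by
      intro x y hxy
      have hz : x⁻¹ * y ∈ K := QuotientGroup.leftRel_apply.1 hxy
      have hy : y = x * (x⁻¹ * y) := by group
      change ((r x : G) : G ⧸ K) = ((r y : G) : G ⧸ K)
      rw [hy, hr.mul_of_mem_center x ((hK _).1 hz).1]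
      exact (QuotientGroup.mk_mul_of_mem _ (hrK _ hz)).symm)
    have hqmk : ∀ x : G, q (x : G ⧸ K) = (r x : G) := fun x => rfl
    have hqit : ∀ (k : ℕ) (x : G), q^[k] (x : G ⧸ K) = (r^[k] x : G) := by
      intro k x
      induction k with
      | zero => rfl
      | succ k ih => rw [Function.iterate_succ_apply', ih, hqmk, Function.iterate_succ_apply']
    have hq : IsSquareRoot q := by
      refine ⟨?_, fun x => ?_, fun x => ?_⟩
      · exact (continuous_quot_mk.comp hr.continuous).quotient_lift _
      · obtain ⟨x, rfl⟩ := QuotientGroup.mk_surjective x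
        rw [hqmk, ← QuotientGroup.mk_mul, hr.mul_self]
      · obtain ⟨x, rfl⟩ := QuotientGroup.mk_surjective x
        rw [← QuotientGroup.mk_mul, hqmk, hr.apply_mul_self]
    have hmk : map ((↑) : G → G ⧸ K) (𝓝 1) = 𝓝 1 :=
      (QuotientGroup.nhds_eq K 1).symm
    have : ConnectedSpace (G ⧸ K) := QuotientGroup.mk_surjective.connectedSpace continuous_quot_mk
    have hmkc : Tendsto ((↑) : G → G ⧸ K) (𝓝 1) (𝓝 1) := hmk.le
    have hlim := ih (G ⧸ K) q hq (by
      rw [← hmk, eventually_map]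
      filter_upwards [hB] with x hx
      have h1 := hmkc.comp hx
      rw [← hmk] at h1
      exact h1.congr fun k => (hqit k x).symm)
      (lowerCentralSeries_quotient_eq_bot hle) x
    have hev : ∀ᶠ y in 𝓝 (1 : G ⧸ K), ∃ b : G, Tendsto (fun k => r^[k] b) atTop (𝓝 1) ∧
        (b : G ⧸ K) = y := by
      rw [← hmk, eventually_map]
      filter_upwards [hB] with x hx
      exact ⟨x, hx, rfl⟩
    obtain ⟨k, b, hb, hbk⟩ := (hlim.eventually hev).exists
    rw [hqit, QuotientGroup.eq] at hbk
    obtain ⟨hz, hz'⟩ := (hK _).1 hbk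
    have h1 := hmul G r hr b _ hz hb hz'
    rw [mul_inv_cancel_left] at h1
    rw [← tendsto_add_atTop_iff_nat k]
    exact h1.congr fun j => (Function.iterate_add_apply r j k x).symm

section Contraction

variable (E : Type*) [NormedAddCommGroup E] [NormedSpace ℝ E] {N : Type u} [TopologicalSpace N]
  [ChartedSpace E N] [Group N] [LieGroup 𝓘(ℝ, E) ∞ N] {r : N → N}

include E

/-- Arbitrarily small neighbourhoods of `1` are contracted into themselves by the square root. -/
theorem IsSquareRoot.exists_nhds_mapsTo (hr : IsSquareRoot r) {V : Set N} (hV : V ∈ 𝓝 1) :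
    ∃ B ∈ 𝓝 (1 : N), B ⊆ V ∧ ∀ x ∈ B, r x ∈ B ∧ Tendsto (fun k => r^[k] x) atTop (𝓝 1) := by
  set φ := chartAtOne E N with hφ
  have hr1 : Tendsto r (𝓝 1) (𝓝 1) := by
    simpa [ContinuousAt, hr.apply_one] using hr.continuous.continuousAt (x := (1 : N))
  have hev : ∀ᶠ x in 𝓝 (1 : N), x ∈ V ∧ r x ∈ φ.source ∧ 3 / 2 * ‖φ (r x) - φ 1‖ ≤ ‖φ x - φ 1‖ := by
    filter_upwards [hV, hr1.eventually (eventually_le_norm_mul_self (E := E) (N := N)),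
      hr1.eventually (chartAtOne_source_mem_nhds (E := E) (N := N))] with x h1 h2 h3
    rw [hr.mul_self] at h2
    exact ⟨h1, h3, h2⟩
  obtain ⟨ε, hε, hball⟩ := Metric.eventually_nhds_iff.1
    ((tendsto_chartAtOne_symm (E := E) (N := N)).eventually hev)
  have hB : ∀ x ∈ φ.source, ‖φ x - φ 1‖ < ε → x ∈ V ∧ r x ∈ φ.source ∧
      3 / 2 * ‖φ (r x) - φ 1‖ ≤ ‖φ x - φ 1‖ := by
    intro x hx hxε
    have := hball (y := φ x) (by rwa [dist_eq_norm])
    rwa [φ.left_inv hx] at this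
  refine ⟨{x | x ∈ φ.source ∧ ‖φ x - φ 1‖ < ε}, ?_, fun x hx => (hB x hx.1 hx.2).1, ?_⟩
  · have hc : Tendsto (fun x => ‖φ x - φ 1‖) (𝓝 (1 : N)) (𝓝 0) :=
      tendsto_iff_norm_sub_tendsto_zero.1 continuousAt_chartAtOne
    exact inter_mem chartAtOne_source_mem_nhds (hc.eventually (gt_mem_nhds hε))
  · have hstep : ∀ x, x ∈ φ.source ∧ ‖φ x - φ 1‖ < ε → r x ∈ φ.source ∧ ‖φ (r x) - φ 1‖ < ε := by
      rintro x ⟨hx, hxε⟩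
      obtain ⟨-, h2, h3⟩ := hB x hx hxε
      refine ⟨h2, ?_⟩
      have := norm_nonneg (φ (r x) - φ 1)
      linarith
    rintro x hx
    refine ⟨hstep x hx, ?_⟩
    have hit : ∀ k : ℕ, (r^[k] x ∈ φ.source ∧ ‖φ (r^[k] x) - φ 1‖ < ε) ∧
        ‖φ (r^[k] x) - φ 1‖ ≤ (2 / 3) ^ k * ε := by
      intro k
      induction k with
      | zero => exact ⟨hx, by simpa using hx.2.le⟩
      | succ k ih =>
        rw [Function.iterate_succ_apply']
        refine ⟨hstep _ ih.1, ?_⟩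
        have h3 := (hB _ ih.1.1 ih.1.2).2.2
        have h4 := ih.2
        rw [pow_succ]
        linarith
    have h0 : Tendsto (fun k => φ (r^[k] x)) atTop (𝓝 (φ 1)) := by
      rw [tendsto_iff_norm_sub_tendsto_zero]
      refine squeeze_zero (fun _ => norm_nonneg _) (fun k => (hit k).2) ?_
      have := (tendsto_pow_atTop_nhds_zero_of_lt_one (r := (2 / 3 : ℝ)) (by norm_num)
        (by norm_num)).mul_const ε
      simpa using this
    exact ((tendsto_chartAtOne_symm (E := E) (N := N)).comp h0).congr fun k =>
      φ.left_inv (hit k).1.1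

/-- The iterated square roots contract compact sets to the identity. -/
theorem IsSquareRoot.exists_forall_iterate_mem [ConnectedSpace N] [Group.IsNilpotent N]
    (hr : IsSquareRoot r) {K : Set N} (hK : IsCompact K) {V : Set N} (hV : V ∈ 𝓝 1) :
    ∃ k, ∀ x ∈ K, r^[k] x ∈ V := by
  have := topologicalGroup_of_lieGroup 𝓘(ℝ, E) ∞ (G := N)
  obtain ⟨n, hn⟩ := (Subgroup.nilpotent_iff_lowerCentralSeries (G := N)).1 inferInstance
  have hn' : (⊤ : Subgroup N).lowerCentralSeries (n + 1) = ⊥ := by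
    rw [eq_bot_iff, ← hn]
    exact Subgroup.lowerCentralSeries_antitone _ n.le_succ
  obtain ⟨B, hB, hBV, hBr⟩ := hr.exists_nhds_mapsTo E hV
  have hlim := tendsto_iterate_of_eventually n N r hr (mem_of_superset hB fun x hx => (hBr x hx).2)
    hn'
  have hmono : ∀ j k x, j ≤ k → r^[j] x ∈ B → r^[k] x ∈ B := by
    intro j k x hjk hx
    induction k, hjk using Nat.le_induction with
    | base => exact hx
    | succ k _ ih => rw [Function.iterate_succ_apply']; exact (hBr _ ih).1
  have hex : ∀ x, ∃ k, {y | r^[k] y ∈ B} ∈ 𝓝 x := by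
    intro x
    obtain ⟨k, hk⟩ := ((hlim x).eventually (eventually_mem_nhds_iff.2 hB)).exists
    exact ⟨k, (hr.iterate_continuous k).continuousAt hk⟩
  choose k hk using hex
  obtain ⟨t, -, ht⟩ := hK.elim_nhds_subcover (fun x => {y | r^[k x] y ∈ B}) fun x _ => hk x
  refine ⟨t.sup k, fun x hx => ?_⟩
  obtain ⟨y, hy, hxy⟩ := Set.mem_iUnion₂.1 (ht hx)
  exact hBV (hmono _ _ x (Finset.le_sup hy) hxy)

end Contraction

end SquareRoot

/-! ### Bounded subsets of simply connected nilpotent groups -/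

section Bounded

open Filter Topology
open scoped commutatorElement Pointwise

universe u

variable (E : Type*) [NormedAddCommGroup E] [NormedSpace ℝ E] {N : Type u} [TopologicalSpace N]
  [T2Space N] [ChartedSpace E N] [Group N] [LieGroup 𝓘(ℝ, E) ∞ N] [ConnectedSpace N]
  [Group.IsNilpotent N] {r : N → N}

include E

theorem IsSquareRoot.eq_one_of_pow_mem (hr : IsSquareRoot r) {K : Set N} (hK : IsCompact K)
    {y : N} (hy : ∀ n : ℕ, y ^ n ∈ K) : y = 1 := by
  have h : pure y ≤ 𝓝 (1 : N) := by
    intro V hV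
    obtain ⟨k, hk⟩ := hr.exists_forall_iterate_mem E hK hV
    have := hk _ (hy (2 ^ k))
    rwa [hr.iterate_pow] at this
  exact pure_le_nhds_iff.1 h

/-- An element with relatively compact conjugacy class is central: an element of the second center
with this property has a bounded commutator homomorphism, and descent along the upper central series
reduces to this case. -/
theorem IsSquareRoot.mem_center_of_conj_mem (hr : IsSquareRoot r) {m : N} {K : Set N}
    (hK : IsCompact K) (hm : ∀ x, x * m * x⁻¹ ∈ K) : m ∈ Subgroup.center N := by
  have := topologicalGroup_of_lieGroup 𝓘(ℝ, E) ∞ (G := N)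
  have key : ∀ (i : ℕ) (m : N), m ∈ Subgroup.upperCentralSeries N i →
      (∃ K, IsCompact K ∧ ∀ x, x * m * x⁻¹ ∈ K) → m ∈ Subgroup.center N := by
    intro i
    induction i with
    | zero =>
      intro m hm _
      rw [Subgroup.upperCentralSeries_zero, Subgroup.mem_bot] at hm
      exact hm ▸ one_mem _
    | succ i ih =>
      rintro m hm ⟨K, hK, hmK⟩
      have hcomm : ∀ y, ∀ x, x * ⁅m, y⁆ * x⁻¹ ∈ K * K⁻¹ := by
        intro y x
        refine Set.mem_mul.2 ⟨_, hmK x, _, Set.inv_mem_inv.2 (hmK (x * y)), ?_⟩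
        rw [commutatorElement_def]; group
      have hcen : ∀ y, ⁅m, y⁆ ∈ Subgroup.center N := fun y =>
        ih _ (Subgroup.mem_upperCentralSeries_succ_iff.1 hm y) ⟨_, hK.mul hK.inv, hcomm y⟩
      refine Subgroup.mem_center_iff.2 fun y => ?_
      have h1 : ⁅m, y⁆ = 1 := by
        refine hr.eq_one_of_pow_mem E (hK.mul hK.inv) fun n => ?_
        have := hcomm (y ^ n) 1
        rwa [one_mul, inv_one, mul_one, ← commutatorHom_apply m hcen, map_pow,
          commutatorHom_apply] at this
      exact (commutatorElement_eq_one_iff_mul_comm.1 h1).symm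
  obtain ⟨n, hn⟩ := Group.IsNilpotent.nilpotent N
  exact key n m (hn ▸ Subgroup.mem_top m) ⟨K, hK, hm⟩

end Bounded

/-! ### Hyperbolic linear maps -/

section Linear

open Filter Topology

/-- No eigenvalue of the complexification has absolute value `1`. -/
def IsHyperbolicEnd {E : Type*} [AddCommGroup E] [Module ℝ E] (D : Module.End ℝ E) : Prop :=
  ∀ μ : ℂ, Module.End.HasEigenvalue (D.baseChange ℂ : Module.End ℂ (ℂ ⊗[ℝ] E)) μ → ‖μ‖ ≠ 1

theorem IsHyperbolicEnd.pow {E : Type*} [AddCommGroup E] [Module ℝ E] [FiniteDimensional ℝ E]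
    {D : Module.End ℝ E} (hD : IsHyperbolicEnd D) {n : ℕ} (hn : 0 < n) :
    IsHyperbolicEnd (D ^ n) := by
  intro μ hμ hμ1
  have h1 : (D ^ n).baseChange ℂ = (D.baseChange ℂ : Module.End ℂ (ℂ ⊗[ℝ] E)) ^ n :=
    LinearMap.baseChange_pow ℝ ℂ E D n
  rw [h1, Module.End.hasEigenvalue_iff_mem_spectrum, spectrum.map_pow_of_pos _ hn] at hμ
  obtain ⟨ν, hν, rfl⟩ := hμ
  refine hD ν (Module.End.hasEigenvalue_iff_mem_spectrum.2 hν) ?_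
  rw [norm_pow] at hμ1
  exact (pow_eq_one_iff_of_nonneg (norm_nonneg _) hn.ne').1 hμ1

/-- The increasing filtration of `V` by the vectors on which products of `i` operators `R x - 1`
vanish. -/
def unipotentFiltration {V X : Type*} [AddCommGroup V] [Module ℂ V] (R : X → Module.End ℂ V) :
    ℕ → Submodule ℂ V
  | 0 => ⊥
  | i + 1 => ⨅ x, (unipotentFiltration R i).comap (R x - 1)

/-- Multiplying an operator `D` by an element of a unipotent family normalized by `D` creates no
new eigenvalues: both operators agree on the graded pieces of a filtration preserved by `D`. -/
theorem hasEigenvalue_of_unipotent_mul {V X : Type*} [AddCommGroup V] [Module ℂ V]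
    [FiniteDimensional ℂ V] {R : X → Module.End ℂ V} {c : ℕ}
    (hR : ∀ l : List X, l.length = c → (l.map fun x => R x - 1).prod = 0)
    {D : Module.End ℂ V} {A : X → X} (hA : Function.Surjective A)
    (hDR : ∀ x, D * R x = R (A x) * D) {v : X} {μ : ℂ}
    (h : Module.End.HasEigenvalue (R v * D) μ) : Module.End.HasEigenvalue D μ := by
  by_contra hμ
  have hmem : ∀ i w, w ∈ unipotentFiltration R (i + 1) ↔
      ∀ x, (R x - 1) w ∈ unipotentFiltration R i := by
    intro i w
    simp only [unipotentFiltration, Submodule.mem_iInf, Submodule.mem_comap]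
  have hD : ∀ i, ∀ w ∈ unipotentFiltration R i, D w ∈ unipotentFiltration R i := by
    intro i
    induction i with
    | zero =>
      intro w hw
      simp only [unipotentFiltration, Submodule.mem_bot] at hw ⊢
      rw [hw, map_zero]
    | succ i ih =>
      intro w hw
      rw [hmem] at hw ⊢
      intro x
      obtain ⟨x, rfl⟩ := hA x
      have h1 : (R (A x) - 1) (D w) = D ((R x - 1) w) := by
        have := congrArg (fun T : Module.End ℂ V => T w) (hDR x)
        simp only [Module.End.mul_apply] at this
        simp only [LinearMap.sub_apply, Module.End.one_apply, map_sub, this]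
      rw [h1]
      exact ih _ (hw x)
  have htop : ∀ i w, (∀ l : List X, l.length = i → (l.map fun x => R x - 1).prod w = 0) →
      w ∈ unipotentFiltration R i := by
    intro i
    induction i with
    | zero =>
      intro w hw
      simpa [unipotentFiltration] using hw [] rfl
    | succ i ih =>
      intro w hw
      rw [hmem]
      refine fun x => ih _ fun l hl => ?_
      have := hw (l ++ [x]) (by simp [hl])
      simpa using this
  have hinj : ∀ w, (D - algebraMap ℂ (Module.End ℂ V) μ) w = 0 → w = 0 := by
    intro w hw
    by_contra hw0
    refine hμ (Module.End.hasEigenvalue_of_hasEigenvector (x := w) ⟨?_, hw0⟩)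
    rw [Module.End.mem_eigenspace_iff]
    simpa [sub_eq_zero, Module.algebraMap_end_apply] using hw
  obtain ⟨w, hw⟩ := h.exists_hasEigenvector
  have hw1 : R v (D w) = μ • w := hw.apply_eq_smul
  have hzero : ∀ i, w ∈ unipotentFiltration R i → w = 0 := by
    intro i
    induction i with
    | zero => intro hwi; simpa [unipotentFiltration] using hwi
    | succ i ih =>
      intro hwi
      refine ih ?_
      have h1 : (D - algebraMap ℂ (Module.End ℂ V) μ) w ∈ unipotentFiltration R i := by
        have h2 := (hmem i _).1 (hD _ _ hwi) v
        rw [LinearMap.sub_apply, Module.End.one_apply, hw1] at h2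
        have h3 := (unipotentFiltration R i).neg_mem h2
        rwa [neg_sub] at h3
      -- `D - μ` is injective, hence bijective, on the finite-dimensional invariant subspace
      have hpres : ∀ w ∈ unipotentFiltration R i,
          (D - algebraMap ℂ (Module.End ℂ V) μ) w ∈ unipotentFiltration R i := fun w hw =>
        (unipotentFiltration R i).sub_mem (hD _ _ hw) ((unipotentFiltration R i).smul_mem μ hw)
      have hsurj : Function.Surjective
          ((D - algebraMap ℂ (Module.End ℂ V) μ).restrict hpres) := by
        refine LinearMap.injective_iff_surjective.1
          ((injective_iff_map_eq_zero _).2 fun a ha => ?_)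
        exact Subtype.ext (hinj a (congrArg Subtype.val ha))
      obtain ⟨w', hw'⟩ := hsurj ⟨_, h1⟩
      have h4 := congrArg Subtype.val hw'
      simp only [LinearMap.coe_restrict_apply] at h4
      have h5 : w - w' = 0 := hinj _ (by rw [map_sub, h4, sub_self])
      rw [sub_eq_zero.1 h5]
      exact w'.2
  exact hw.2 (hzero c (htop c w fun l hl => by rw [hR l hl]; rfl))

theorem IsHyperbolicEnd.unipotent_mul {E X : Type*} [AddCommGroup E] [Module ℝ E]
    [FiniteDimensional ℝ E] {R : X → Module.End ℝ E} {c : ℕ}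
    (hR : ∀ l : List X, l.length = c → (l.map fun x => R x - 1).prod = 0)
    {D : Module.End ℝ E} (hD : IsHyperbolicEnd D) {A : X → X} (hA : Function.Surjective A)
    (hDR : ∀ x, D * R x = R (A x) * D) (v : X) : IsHyperbolicEnd (R v * D) := by
  intro μ hμ
  refine hD μ ?_
  let β : Module.End ℝ E →ₐ[ℝ] Module.End ℂ (ℂ ⊗[ℝ] E) := Module.End.baseChangeHom ℝ ℂ E
  refine hasEigenvalue_of_unipotent_mul (R := fun x => β (R x)) (c := c) ?_ hA ?_ (v := v) (μ := μ)
    (D := β D) ?_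
  · intro l hl
    have := congrArg β (hR l hl)
    rw [map_list_prod, List.map_map, map_zero] at this
    simpa [Function.comp_def] using this
  · intro x
    rw [← map_mul, hDR, map_mul]
  · rw [← map_mul]
    exact hμ

variable {E : Type*} [NormedAddCommGroup E] [NormedSpace ℝ E] [FiniteDimensional ℝ E]

/-- The only vector with bounded two-sided orbit under a hyperbolic linear automorphism is `0`:
on the subspace of such vectors, every complex eigenvalue has absolute value `1`. -/
theorem IsHyperbolicEnd.eq_zero_of_bounded {D : E ≃L[ℝ] E}
    (hD : IsHyperbolicEnd (D : E →L[ℝ] E).toLinearMap) {w : E} {C : ℝ}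
    (hw : ∀ n : ℤ, ‖(D ^ n) w‖ ≤ C) : w = 0 := by
  let S : Submodule ℝ E :=
    { carrier := {w | ∃ C, ∀ n : ℤ, ‖(D ^ n) w‖ ≤ C}
      zero_mem' := ⟨0, fun n => by simp⟩
      add_mem' := by
        rintro a b ⟨C, hC⟩ ⟨C', hC'⟩
        refine ⟨C + C', fun n => ?_⟩
        rw [map_add]
        exact (norm_add_le _ _).trans (add_le_add (hC n) (hC' n))
      smul_mem' := by
        rintro t a ⟨C, hC⟩
        refine ⟨‖t‖ * C, fun n => ?_⟩
        rw [map_smul, norm_smul]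
        exact mul_le_mul_of_nonneg_left (hC n) (norm_nonneg t) }
  have hS : ∀ w ∈ S, (D : E →L[ℝ] E).toLinearMap w ∈ S := by
    rintro w ⟨C, hC⟩
    refine ⟨C, fun n => ?_⟩
    have := hC (n + 1)
    rw [zpow_add, zpow_one] at this
    exact this
  by_contra hw0
  have : Nontrivial S := ⟨⟨w, C, hw⟩, 0, fun h => hw0 (congrArg Subtype.val h)⟩
  have : Nontrivial (ℂ ⊗[ℝ] S) := inferInstance
  let DS : Module.End ℝ S := (D : E →L[ℝ] E).toLinearMap.restrict hS
  obtain ⟨μ, hμ⟩ := Module.End.exists_eigenvalue (DS.baseChange ℂ : Module.End ℂ (ℂ ⊗[ℝ] S))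
  obtain ⟨x, hx⟩ := hμ.exists_hasEigenvector
  have hx1 : DS.baseChange ℂ x = μ • x := hx.apply_eq_smul
  let ι : ℂ ⊗[ℝ] S →ₗ[ℂ] ℂ ⊗[ℝ] E := S.subtype.baseChange ℂ
  have hι : Function.Injective ι :=
    Module.Flat.lTensor_preserves_injective_linearMap (M := ℂ) S.subtype S.injective_subtype
  have hιx : ι x ≠ 0 := fun h => hx.2 (hι (h.trans (map_zero ι).symm))
  have hcomm : ∀ y, ((D : E →L[ℝ] E).toLinearMap.baseChange ℂ) (ι y) = ι (DS.baseChange ℂ y) := by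
    intro y
    have h1 : (D : E →L[ℝ] E).toLinearMap ∘ₗ S.subtype = S.subtype ∘ₗ DS := rfl
    have h2 := congrArg (LinearMap.baseChange ℂ) h1
    rw [LinearMap.baseChange_comp, LinearMap.baseChange_comp] at h2
    exact congrArg (fun T => T y) h2
  have hDx : ((D : E →L[ℝ] E).toLinearMap.baseChange ℂ) (ι x) = μ • ι x := by
    rw [hcomm, hx1, map_smul]
  let β : ℤ → ℂ ⊗[ℝ] E →ₗ[ℂ] ℂ ⊗[ℝ] E := fun n =>
    ((D ^ n : E ≃L[ℝ] E) : E →L[ℝ] E).toLinearMap.baseChange ℂ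
  have hβadd : ∀ m n y, β (m + n) y = β m (β n y) := by
    intro m n y
    have h1 : ((D ^ (m + n) : E ≃L[ℝ] E) : E →L[ℝ] E).toLinearMap
        = ((D ^ m : E ≃L[ℝ] E) : E →L[ℝ] E).toLinearMap ∘ₗ
          ((D ^ n : E ≃L[ℝ] E) : E →L[ℝ] E).toLinearMap := by
      rw [zpow_add]; rfl
    simp only [β]
    rw [h1, LinearMap.baseChange_comp]
    rfl
  have hβ0 : ∀ y, β 0 y = y := by
    intro y
    have h1 : ((D ^ (0 : ℤ) : E ≃L[ℝ] E) : E →L[ℝ] E).toLinearMap = LinearMap.id := by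
      rw [zpow_zero]; rfl
    simp only [β]
    rw [h1, LinearMap.baseChange_id]
    rfl
  have hβ1 : β 1 (ι x) = μ • ι x := by
    simp only [β, zpow_one]
    exact hDx
  have hpow : ∀ n : ℕ, β n (ι x) = μ ^ n • ι x := by
    intro n
    induction n with
    | zero => simpa using hβ0 _
    | succ n ih =>
      rw [Nat.cast_succ, add_comm, hβadd, ih, map_smul, hβ1, smul_smul, pow_succ]
  have hneg : ∀ n : ℕ, μ ^ n • β (-n) (ι x) = ι x := by
    intro n
    rw [← map_smul, ← hpow, ← hβadd, neg_add_cancel, hβ0]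
  -- coordinates of the orbit are bounded
  let b := Module.finBasis ℝ E
  let bc := b.baseChange ℂ
  have hbd : ∀ (y : ℂ ⊗[ℝ] S) (i), ∃ C, ∀ n, ‖bc.repr (β n (ι y)) i‖ ≤ C := by
    intro y i
    induction y using TensorProduct.induction_on with
    | zero => exact ⟨0, fun n => by simp⟩
    | tmul z s =>
      obtain ⟨s, C, hs⟩ := s
      let ℓ : E →L[ℝ] ℝ := LinearMap.toContinuousLinearMap (b.coord i)
      refine ⟨‖ℓ‖ * C * ‖z‖, fun n => ?_⟩
      have h1 : bc.repr (β n (ι (z ⊗ₜ ⟨s, C, hs⟩))) i = ℓ ((D ^ n) s) • z := by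
        simp only [β, ι, bc, LinearMap.baseChange_tmul, Module.Basis.baseChange_repr_tmul]
        rfl
      rw [h1, norm_smul]
      refine mul_le_mul_of_nonneg_right ((ℓ.le_opNorm _).trans ?_) (norm_nonneg z)
      exact mul_le_mul_of_nonneg_left (hs n) (norm_nonneg ℓ)
    | add y y' hy hy' =>
      obtain ⟨C, hC⟩ := hy
      obtain ⟨C', hC'⟩ := hy'
      refine ⟨C + C', fun n => ?_⟩
      rw [map_add, map_add, map_add, Finsupp.add_apply]
      exact (norm_add_le _ _).trans (add_le_add (hC n) (hC' n))
  obtain ⟨i, hi⟩ : ∃ i, bc.repr (ι x) i ≠ 0 := by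
    by_contra! h
    exact hιx (bc.repr.map_eq_zero_iff.1 (Finsupp.ext h))
  obtain ⟨C', hC'⟩ := hbd x i
  have hpos : 0 < ‖bc.repr (ι x) i‖ := norm_pos_iff.2 hi
  have hle : ∀ t : ℝ, 0 ≤ t → (∀ n : ℕ, t ^ n * ‖bc.repr (ι x) i‖ ≤ C') → t ≤ 1 := by
    intro t ht h
    by_contra! h1
    obtain ⟨n, hn⟩ := pow_unbounded_of_one_lt (C' / ‖bc.repr (ι x) i‖) h1
    rw [div_lt_iff₀ hpos] at hn
    exact absurd (h n) (not_le.2 hn)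
  have h1 : ‖μ‖ ≤ 1 := by
    refine hle _ (norm_nonneg μ) fun n => ?_
    have := hC' n
    rwa [hpow, map_smul, Finsupp.smul_apply, norm_smul, norm_pow] at this
  have h2 : 1 ≤ ‖μ‖ := by
    have hμ0 : 0 < ‖μ‖ := by
      rw [norm_pos_iff]
      rintro rfl
      have := hneg 1
      rw [pow_one, zero_smul] at this
      exact hιx this.symm
    have : ‖μ‖⁻¹ ≤ 1 := by
      refine hle _ (inv_nonneg.2 (norm_nonneg μ)) fun n => ?_
      have h3 := hC' (-n)
      have h4 : bc.repr (ι x) i = μ ^ n * bc.repr (β (-n) (ι x)) i := by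
        conv_lhs => rw [← hneg n]
        rw [map_smul, Finsupp.smul_apply, smul_eq_mul]
      rw [h4, norm_mul, norm_pow, ← mul_assoc, ← mul_pow, inv_mul_cancel₀ hμ0.ne', one_pow, one_mul]
      exact h3
    exact (inv_le_one₀ hμ0).1 this
  refine hD μ (Module.End.hasEigenvalue_of_hasEigenvector (x := ι x) ⟨?_, hιx⟩)
    (le_antisymm h1 h2)
  rw [Module.End.mem_eigenspace_iff]
  exact hDx

/-- Uniform expansion in finitely many steps, by compactness of the unit sphere. -/
theorem IsHyperbolicEnd.exists_finset_expanding {D : E ≃L[ℝ] E}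
    (hD : IsHyperbolicEnd (D : E →L[ℝ] E).toLinearMap) :
    ∃ s : Finset ℤ, ∀ w ≠ 0, ∃ n ∈ s, 3 * ‖w‖ < ‖(D ^ n) w‖ := by
  have := FiniteDimensional.proper ℝ E
  obtain ⟨s, hs⟩ := (isCompact_sphere (0 : E) 1).elim_finite_subcover
    (fun n : ℤ => {w | 3 < ‖(D ^ n) w‖})
    (fun n => isOpen_lt continuous_const (D ^ n).continuous.norm) (by
      intro w hw
      by_contra h
      simp only [Set.mem_iUnion, Set.mem_ofPred_eq, not_exists, not_lt] at h
      have := hD.eq_zero_of_bounded h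
      simp [this] at hw)
  refine ⟨s, fun w hw => ?_⟩
  have hw' : 0 < ‖w‖ := norm_pos_iff.2 hw
  obtain ⟨n, hn, hn'⟩ := Set.mem_iUnion₂.1 (hs (show ‖w‖⁻¹ • w ∈ Metric.sphere (0 : E) 1 by
    simp [norm_smul, hw'.ne']))
  refine ⟨n, hn, ?_⟩
  simp only [Set.mem_ofPred_eq, map_smul, norm_smul, norm_inv, norm_norm] at hn'
  rwa [inv_mul_eq_div, lt_div_iff₀ hw'] at hn'

end Linear

/-! ### Bounded orbits of hyperbolic automorphisms -/

section HyperbolicAut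

open Filter Topology

universe u

variable {E : Type*} [NormedAddCommGroup E] [NormedSpace ℝ E] {N : Type u} [TopologicalSpace N]
  [ChartedSpace E N] [Group N]

theorem HasDerivAtOne.mulAut_pow {A : MulAut N} {D : E →L[ℝ] E} (hA : HasDerivAtOne A D) (n : ℕ) :
    HasDerivAtOne (A ^ n : MulAut N) (D ^ n) := by
  induction n with
  | zero => exact HasDerivAtOne.id
  | succ n ih =>
    have := ih.comp hA
    rw [pow_succ, pow_succ]
    exact this

/-- The differential of an automorphism and of its inverse, as a linear equivalence. -/
theorem HasDerivAtOne.exists_equiv {A : MulAut N} {D D' : E →L[ℝ] E} (hA : HasDerivAtOne A D)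
    (hA' : HasDerivAtOne (A⁻¹ : MulAut N) D') :
    ∃ e : E ≃L[ℝ] E, (e : E →L[ℝ] E) = D ∧
      ∀ n : ℤ, HasDerivAtOne (A ^ n : MulAut N) ((e ^ n : E ≃L[ℝ] E) : E →L[ℝ] E) := by
  have h1 : D' ∘L D = ContinuousLinearMap.id ℝ E := by
    refine (hA'.comp hA).unique ?_
    convert HasDerivAtOne.id (E := E) (N := N) using 1
    funext x; simp
  have h2 : D ∘L D' = ContinuousLinearMap.id ℝ E := by
    refine (hA.comp hA').unique ?_
    convert HasDerivAtOne.id (E := E) (N := N) using 1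
    funext x; simp
  let e : E ≃L[ℝ] E := ContinuousLinearEquiv.equivOfInverse D D'
    (fun x => congrArg (fun T => T x) h1) (fun x => congrArg (fun T => T x) h2)
  have hpow : ∀ (f : E ≃L[ℝ] E) (n : ℕ),
      ((f ^ n : E ≃L[ℝ] E) : E →L[ℝ] E) = (f : E →L[ℝ] E) ^ n := by
    intro f n
    induction n with
    | zero => rfl
    | succ n ih => rw [pow_succ, pow_succ, ← ih]; rfl
  refine ⟨e, rfl, fun n => ?_⟩
  obtain ⟨n, rfl | rfl⟩ := n.eq_nat_or_neg
  · rw [zpow_natCast, zpow_natCast, hpow]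
    exact hA.mulAut_pow n
  · rw [zpow_neg, zpow_neg, zpow_natCast, zpow_natCast, ← inv_pow, ← inv_pow, hpow]
    exact hA'.mulAut_pow n

variable [LieGroup 𝓘(ℝ, E) ∞ N] [ConnectedSpace N]
  [Group.IsNilpotent N] [FiniteDimensional ℝ E] {r : N → N}

/-- A two-sided orbit of a hyperbolic automorphism that stays in a compact set is trivial. Iterated
square roots move the orbit into a small neighbourhood of `1`, where expansion in finitely many
steps makes it grow without bound unless it is constantly `1`. -/
theorem IsSquareRoot.eq_one_of_zpow_mem (hr : IsSquareRoot r) {A : MulAut N} {D D' : E →L[ℝ] E}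
    (hA : HasDerivAtOne A D) (hA' : HasDerivAtOne (A⁻¹ : MulAut N) D')
    (hD : IsHyperbolicEnd D.toLinearMap) {K : Set N} (hK : IsCompact K) {y : N}
    (hy : ∀ n : ℤ, (A ^ n) y ∈ K) : y = 1 := by
  obtain ⟨e, rfl, he⟩ := hA.exists_equiv hA'
  obtain ⟨s, hs⟩ := hD.exists_finset_expanding
  let ν : N → E := fun x => chartAtOne E N x - chartAtOne E N 1
  have hν : Tendsto (fun x => ‖ν x‖) (𝓝 1) (𝓝 0) :=
    tendsto_iff_norm_sub_tendsto_zero.1 continuousAt_chartAtOne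
  have hev : ∀ᶠ x in 𝓝 (1 : N), (x ∈ (chartAtOne E N).source ∧ ‖ν x‖ < 1) ∧
      ∀ n ∈ s, ‖ν ((A ^ n) x) - (e ^ n) (ν x)‖ ≤ 1 * ‖ν x‖ := by
    refine Filter.Eventually.and (inter_mem chartAtOne_source_mem_nhds
      (hν.eventually (gt_mem_nhds one_pos))) ?_
    rw [Filter.eventually_all_finset]
    exact fun n _ => (he n).isLittleO.bound one_pos
  obtain ⟨k, hk⟩ := hr.exists_forall_iterate_mem E hK hev
  have horb : ∀ n : ℤ, (A ^ n) (r^[k] y) = r^[k] ((A ^ n) y) := fun n =>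
    (hr.map_iterate_apply (A ^ n : MulAut N).toMonoidHom k y).symm
  have hV := fun n : ℤ => hk _ (hy n)
  simp only [← horb] at hV
  have hone : r^[k] y = 1 := by
    by_contra hne
    have hpos : 0 < ‖ν (r^[k] y)‖ := by
      rw [norm_pos_iff, sub_ne_zero]
      intro h
      exact hne ((chartAtOne E N).injOn (hV 0).1.1 (mem_of_mem_nhds chartAtOne_source_mem_nhds) h)
    have hgrow : ∀ j : ℕ, ∃ n : ℤ, 2 ^ j * ‖ν (r^[k] y)‖ ≤ ‖ν ((A ^ n) (r^[k] y))‖ := by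
      intro j
      induction j with
      | zero => exact ⟨0, by simp⟩
      | succ j ih =>
        obtain ⟨n, hn⟩ := ih
        have hpos' : 0 < ‖ν ((A ^ n) (r^[k] y))‖ := lt_of_lt_of_le (by positivity) hn
        obtain ⟨m, hm, hm'⟩ := hs _ (norm_pos_iff.1 hpos')
        have h1 := (hV n).2 m hm
        refine ⟨m + n, ?_⟩
        rw [zpow_add, MulAut.mul_apply]
        set a := ν ((A ^ m) ((A ^ n) (r^[k] y)))
        set b := (e ^ m) (ν ((A ^ n) (r^[k] y)))
        have h2 : ‖b‖ ≤ ‖a‖ + ‖a - b‖ := by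
          calc ‖b‖ = ‖a - (a - b)‖ := by congr 1; abel
            _ ≤ _ := norm_sub_le _ _
        rw [pow_succ]
        linarith
    obtain ⟨j, hj⟩ := pow_unbounded_of_one_lt (1 / ‖ν (r^[k] y)‖) (one_lt_two (α := ℝ))
    rw [div_lt_iff₀ hpos] at hj
    obtain ⟨n, hn⟩ := hgrow j
    have := (hV n).1.2
    linarith
  have := hr.pow_iterate k y
  rw [hone, one_pow] at this
  exact this.symm

end HyperbolicAut

/-! ### The fixed subgroup of a finite group of automorphisms -/

section FixedPoints

open Filter Topology
open scoped unitInterval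

universe u

variable {E : Type*} [NormedAddCommGroup E] [NormedSpace ℝ E] [FiniteDimensional ℝ E]
  {N : Type u} [TopologicalSpace N]
  [ChartedSpace E N] [Group N] [LieGroup 𝓘(ℝ, E) ∞ N]

/-- Near the identity, common fixed points of a finite group of automorphisms are joined to `1` by
paths of fixed points: averaging a chart over the group makes the action linear. -/
theorem exists_nhds_fixed_path (P : Subgroup (MulAut N)) [Finite P]
    (hP : ∀ B ∈ P, ContMDiff 𝓘(ℝ, E) 𝓘(ℝ, E) ∞ (B : N → N)) :
    ∃ V ∈ 𝓝 (1 : N), ∀ c ∈ V, (∀ B ∈ P, B c = c) →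
      ∃ p : C(I, N), p 0 = c ∧ p 1 = 1 ∧ ∀ t, ∀ B ∈ P, B (p t) = p t := by
  have := FiniteDimensional.complete ℝ E
  have := Fintype.ofFinite P
  set φ := chartAtOne E N with hφ
  have hex : ∀ B : P, ∃ D : E →L[ℝ] E, HasDerivAtOne (B : MulAut N) D := fun B => by
    obtain ⟨D, -, hD⟩ := (hP B B.2).hasDerivAtOne (map_one _)
    exact ⟨D, hD⟩
  choose D hD using hex
  have hDmul : ∀ B B' : P, D (B * B') = D B ∘L D B' := fun B B' =>
    (hD (B * B')).unique ((hD B).comp (hD B'))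
  have hDone : D 1 = ContinuousLinearMap.id ℝ E := (hD 1).unique HasDerivAtOne.id
  have hcard : (Fintype.card P : ℝ) ≠ 0 := by exact_mod_cast Fintype.card_ne_zero
  -- the averaged chart
  let a : N → E := fun x => (Fintype.card P : ℝ)⁻¹ • ∑ B : P, D B⁻¹ (φ ((B : MulAut N) x) - φ 1)
  have ha1 : a 1 = 0 := by simp [a]
  have hequiv : ∀ (B : P) (x : N), a ((B : MulAut N) x) = D B (a x) := by
    intro B x
    simp only [a, map_smul, map_sum]
    congr 1
    refine Fintype.sum_equiv (Equiv.mulRight B) _ _ fun B' => ?_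
    have h1 : D B'⁻¹ = D B ∘L D (B' * B)⁻¹ := by rw [← hDmul]; congr 1; group
    rw [h1]
    rfl
  have hstrict : HasStrictFDerivAt (fun u => a (φ.symm u))
      ((ContinuousLinearEquiv.refl ℝ E : E ≃L[ℝ] E) : E →L[ℝ] E) (φ 1) := by
    have h1 : HasStrictFDerivAt (fun u => a (φ.symm u))
        ((Fintype.card P : ℝ)⁻¹ • ∑ B : P, D B⁻¹ ∘L D B) (φ 1) := by
      refine HasStrictFDerivAt.const_smul (HasStrictFDerivAt.fun_sum fun B _ => ?_) _
      exact (D B⁻¹).hasStrictFDerivAt.comp (φ 1) ((hD B).hasStrictFDerivAt.sub_const (φ 1))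
    have h2 : ∀ B : P, D B⁻¹ ∘L D B = ContinuousLinearMap.id ℝ E := fun B => by
      rw [← hDmul, inv_mul_cancel, hDone]
    simp only [h2, Finset.sum_const, Finset.card_univ, ← Nat.cast_smul_eq_nsmul ℝ, smul_smul,
      inv_mul_cancel₀ hcard, one_smul] at h1
    exact h1
  let Ψ := hstrict.toOpenPartialHomeomorph (fun u => a (φ.symm u))
  have hΨ : ∀ u, Ψ u = a (φ.symm u) := fun u => rfl
  have hΨs : φ 1 ∈ Ψ.source := hstrict.mem_toOpenPartialHomeomorph_source
  have hφ1 : φ.symm (φ 1) = 1 := chartAtOne_symm_one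
  have hΨ1 : Ψ (φ 1) = 0 := by rw [hΨ, hφ1, ha1]
  have hΨt : (0 : E) ∈ Ψ.target := hΨ1 ▸ Ψ.map_source hΨs
  have hΨsymm : Ψ.symm 0 = φ 1 := by rw [← hΨ1, Ψ.left_inv hΨs]
  -- points near `1` on which the averaged chart is injective
  have hgood : ∀ᶠ x in 𝓝 (1 : N), x ∈ φ.source ∧ φ x ∈ Ψ.source :=
    Filter.Eventually.and chartAtOne_source_mem_nhds
      (continuousAt_chartAtOne.eventually (Ψ.open_source.mem_nhds hΨs))
  have hinv : ∀ x, x ∈ φ.source ∧ φ x ∈ Ψ.source → φ.symm (Ψ.symm (a x)) = x := by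
    rintro x ⟨h1, h2⟩
    have h3 : a x = Ψ (φ x) := by rw [hΨ, φ.left_inv h1]
    rw [h3, Ψ.left_inv h2, φ.left_inv h1]
  have hσ : Tendsto (fun w => φ.symm (Ψ.symm w)) (𝓝 0) (𝓝 1) := by
    have h1 := Ψ.continuousAt_symm hΨt
    rw [ContinuousAt, hΨsymm] at h1
    exact tendsto_chartAtOne_symm.comp h1
  have hball : ∀ᶠ w in 𝓝 (0 : E), w ∈ Ψ.target ∧ Ψ.symm w ∈ interior φ.target ∧
      ∀ B : P, (B : MulAut N) (φ.symm (Ψ.symm w)) ∈ φ.source ∧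
        φ ((B : MulAut N) (φ.symm (Ψ.symm w))) ∈ Ψ.source := by
    refine Filter.Eventually.and (Ψ.open_target.mem_nhds hΨt) (Filter.Eventually.and ?_ ?_)
    · have h1 := Ψ.continuousAt_symm hΨt
      rw [ContinuousAt, hΨsymm] at h1
      exact h1.eventually (isOpen_interior.mem_nhds (mem_interior_iff_mem_nhds.2
        chartAtOne_target_mem_nhds))
    · rw [Filter.eventually_all]
      exact fun B => ((hD B).tendsto.comp hσ).eventually hgood
  obtain ⟨ε, hε, hεball⟩ := Metric.eventually_nhds_iff.1 hball
  have ha : Tendsto a (𝓝 1) (𝓝 0) := by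
    have h1 : ContinuousAt (fun u => a (φ.symm u)) (φ 1) := hstrict.continuousAt
    rw [ContinuousAt] at h1
    simp only [hφ1, ha1] at h1
    refine (h1.comp continuousAt_chartAtOne).congr' ?_
    filter_upwards [chartAtOne_source_mem_nhds (E := E) (N := N)] with x hx
    simp only [Function.comp]
    rw [φ.left_inv hx]
  refine ⟨{x | (x ∈ φ.source ∧ φ x ∈ Ψ.source) ∧ dist (a x) 0 < ε},
    hgood.and (ha.eventually (Metric.ball_mem_nhds 0 hε)), ?_⟩
  rintro c ⟨hc, hcε⟩ hcP
  have hseg : ∀ t : I, dist ((1 - (t : ℝ)) • a c) 0 < ε := by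
    intro t
    rw [dist_zero_right] at hcε ⊢
    rw [norm_smul, Real.norm_of_nonneg (sub_nonneg.2 t.2.2)]
    refine lt_of_le_of_lt (mul_le_of_le_one_left (norm_nonneg _) ?_) hcε
    linarith [t.2.1]
  refine ⟨⟨fun t => φ.symm (Ψ.symm ((1 - (t : ℝ)) • a c)), ?_⟩, ?_, ?_, ?_⟩
  · rw [continuous_iff_continuousAt]
    intro t
    obtain ⟨h1, h2, -⟩ := hεball (hseg t)
    have h3 : ContinuousAt φ.symm (Ψ.symm ((1 - (t : ℝ)) • a c)) :=
      continuousOn_chartAtOne_symm.continuousAt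
        (mem_interior_iff_mem_nhds.1 h2)
    have h4 : ContinuousAt (fun t : I => (1 - (t : ℝ)) • a c) t := by fun_prop
    exact ContinuousAt.comp (f := fun t : I => Ψ.symm ((1 - (t : ℝ)) • a c)) h3
      (ContinuousAt.comp (f := fun t : I => (1 - (t : ℝ)) • a c) (Ψ.continuousAt_symm h1) h4)
  · simp [hinv c hc]
  · simp [hΨsymm, hφ1]
  · intro t B hB
    obtain ⟨h1, h2, h3⟩ := hεball (hseg t)
    have h4 : a (φ.symm (Ψ.symm ((1 - (t : ℝ)) • a c))) = (1 - (t : ℝ)) • a c := by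
      rw [← hΨ, Ψ.right_inv h1]
    have h5 : D ⟨B, hB⟩ (a c) = a c := by rw [← hequiv]; simp [hcP B hB]
    have h6 := hinv _ (h3 ⟨B, hB⟩)
    rw [hequiv, h4, map_smul, h5] at h6
    exact h6.symm

/-- The common fixed points of a finite group of automorphisms are joined to `1` by paths of fixed
points: the square root commutes with automorphisms and moves a fixed point close to `1`. -/
theorem IsSquareRoot.exists_fixed_path [ConnectedSpace N] [Group.IsNilpotent N] {r : N → N}
    (hr : IsSquareRoot r) (P : Subgroup (MulAut N)) [Finite P]
    (hP : ∀ B ∈ P, ContMDiff 𝓘(ℝ, E) 𝓘(ℝ, E) ∞ (B : N → N)) {c : N} (hc : ∀ B ∈ P, B c = c) :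
    ∃ p : C(I, N), p 0 = c ∧ p 1 = 1 ∧ ∀ t, ∀ B ∈ P, B (p t) = p t := by
  have := topologicalGroup_of_lieGroup 𝓘(ℝ, E) ∞ (G := N)
  obtain ⟨V, hV, h⟩ := exists_nhds_fixed_path P hP
  obtain ⟨k, hk⟩ := hr.exists_forall_iterate_mem E (isCompact_singleton (x := c)) hV
  obtain ⟨p, h0, h1, hp⟩ := h _ (hk c rfl) fun B hB => by
    have := hr.map_iterate_apply B.toMonoidHom k c
    simp only [MulEquiv.toMonoidHom_eq_coe, MonoidHom.coe_coe, hc B hB] at this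
    exact this.symm
  refine ⟨⟨fun t => p t ^ 2 ^ k, by fun_prop⟩, ?_, ?_, fun t B hB => ?_⟩
  · simp [h0, hr.pow_iterate]
  · simp [h1]
  · simp [hp t B hB]

end FixedPoints

/-! ### The action of an infranilmanifold group and its quotient covering -/

section Covering

open Filter Topology
open scoped unitInterval

variable {N G : Type*} [Group N] [Group G] {φ : G →* MulAut N} {Γ : Subgroup (N ⋊[φ] G)}

theorem infranilRightAct_one (x : N) : infranilRightAct φ 1 x = x := by
  simp [infranilRightAct]

theorem infranilRightAct_mul (γ γ' : N ⋊[φ] G) (x : N) :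
    infranilRightAct φ (γ * γ') x = infranilRightAct φ γ' (infranilRightAct φ γ x) := by
  simp [infranilRightAct, mul_assoc]

theorem inl_mul_eq_inr_mul_inl (γ : N ⋊[φ] G) (x : N) :
    (SemidirectProduct.inl x * γ : N ⋊[φ] G)
      = SemidirectProduct.inr γ.right * SemidirectProduct.inl (infranilRightAct φ γ x) := by
  ext <;> simp [infranilRightAct]

theorem Infranilmanifold.proj_eq_iff {x y : N} :
    Infranilmanifold.proj φ Γ x = Infranilmanifold.proj φ Γ y ↔
      ∃ γ ∈ Γ, infranilRightAct φ γ x = y := by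
  refine (DoubleCoset.eq _ _ _ _).trans ?_
  constructor
  · rintro ⟨_, ⟨k, rfl⟩, γ, hγ, h⟩
    refine ⟨γ, hγ, ?_⟩
    rw [mul_assoc, inl_mul_eq_inr_mul_inl, ← mul_assoc, ← map_mul] at h
    have hl := congrArg SemidirectProduct.left h
    have hr := congrArg SemidirectProduct.right h
    simp only [SemidirectProduct.right_inl, SemidirectProduct.mul_right,
      SemidirectProduct.right_inr, mul_one, SemidirectProduct.left_inl,
      SemidirectProduct.mul_left, SemidirectProduct.left_inr, one_mul] at hl hr
    rw [hl, ← hr, map_one, MulAut.one_apply]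
  · rintro ⟨γ, hγ, rfl⟩
    refine ⟨SemidirectProduct.inr γ.right⁻¹, ⟨_, rfl⟩, γ, hγ, ?_⟩
    rw [mul_assoc, inl_mul_eq_inr_mul_inl, ← mul_assoc, ← map_mul]
    simp

theorem Infranilmanifold.proj_surjective :
    Function.Surjective (Infranilmanifold.proj φ Γ) := by
  intro m
  obtain ⟨s, rfl⟩ := Quotient.exists_rep m
  refine ⟨infranilRightAct φ s 1, ?_⟩
  refine (DoubleCoset.eq _ _ _ _).2 ⟨SemidirectProduct.inr s.right, ⟨_, rfl⟩, 1, one_mem _, ?_⟩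
  rw [mul_one, ← inl_mul_eq_inr_mul_inl]
  simp

variable [TopologicalSpace N] [IsTopologicalGroup N] [TopologicalSpace G] [DiscreteTopology G]

theorem SemidirectProduct.isTopologicalGroup (hφ : ∀ g, Continuous (φ g)) :
    IsTopologicalGroup (N ⋊[φ] G) := by
  have hind : Continuous (SemidirectProduct.equivProd (φ := φ)) := continuous_induced_dom
  have hl : Continuous fun s : N ⋊[φ] G => s.left := continuous_fst.comp hind
  have hr : Continuous fun s : N ⋊[φ] G => s.right := continuous_snd.comp hind
  have hφ' : Continuous fun p : G × N => φ p.1 p.2 := continuous_prod_of_discrete_left.2 hφ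
  refine { continuous_mul := ?_, continuous_inv := ?_ }
  · refine continuous_induced_rng.2 (Continuous.prodMk ?_ ?_)
    · exact (hl.comp continuous_fst).mul
        (hφ'.comp ((hr.comp continuous_fst).prodMk (hl.comp continuous_snd)))
    · exact (hr.comp continuous_fst).mul (hr.comp continuous_snd)
  · refine continuous_induced_rng.2 (Continuous.prodMk ?_ hr.inv)
    exact hφ'.comp (hr.inv.prodMk hl.inv)

omit [IsTopologicalGroup N] [DiscreteTopology G] in
theorem SemidirectProduct.continuous_inl :
    Continuous (SemidirectProduct.inl : N →* N ⋊[φ] G) :=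
  continuous_induced_rng.2 (continuous_id.prodMk continuous_const)

omit [TopologicalSpace G] [DiscreteTopology G] in
theorem continuous_infranilRightAct (hφ : ∀ g, Continuous (φ g)) (γ : N ⋊[φ] G) :
    Continuous (infranilRightAct φ γ) :=
  (hφ _).comp (continuous_id.mul continuous_const)

/-- `Γ` as a group of left transformations of `N`, through `γ ↦ γ⁻¹`. -/
@[reducible]
def infranilMulAction (φ : G →* MulAut N) (Γ : Subgroup (N ⋊[φ] G)) : MulAction Γ N where
  smul γ x := infranilRightAct φ (γ : N ⋊[φ] G)⁻¹ x
  one_smul x := by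
    change infranilRightAct φ (1 : N ⋊[φ] G)⁻¹ x = x
    rw [inv_one, infranilRightAct_one]
  mul_smul γ γ' x := by
    change infranilRightAct φ (γ * γ' : N ⋊[φ] G)⁻¹ x = _
    rw [mul_inv_rev, infranilRightAct_mul]
    rfl

theorem Infranilmanifold.isQuotientMap_proj (hφ : ∀ g, Continuous (φ g)) :
    IsQuotientMap (Infranilmanifold.proj φ Γ) := by
  have hind : Continuous (SemidirectProduct.equivProd (φ := φ)) := continuous_induced_dom
  have hρ : Continuous fun s : N ⋊[φ] G => infranilRightAct φ s 1 := by
    have hφ' : Continuous fun p : G × N => φ p.1 p.2 := continuous_prod_of_discrete_left.2 hφ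
    exact hφ'.comp ((continuous_snd.comp hind).inv.prodMk
      (continuous_const.mul (continuous_fst.comp hind)))
  have hmk : ∀ s : N ⋊[φ] G, DoubleCoset.mk (SemidirectProduct.inr : G →* N ⋊[φ] G).range Γ s
      = Infranilmanifold.proj φ Γ (infranilRightAct φ s 1) := by
    intro s
    refine ((DoubleCoset.eq (SemidirectProduct.inr : G →* N ⋊[φ] G).range Γ _ _).2
      ⟨SemidirectProduct.inr s.right, ⟨_, rfl⟩, 1, one_mem _, ?_⟩).symm
    rw [mul_one, ← inl_mul_eq_inr_mul_inl]
    simp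
  refine ⟨isCoinducing_iff.2 fun s => ⟨fun hs => ?_, fun hs =>
    (isOpen_coinduced.1 hs).preimage SemidirectProduct.continuous_inl⟩,
    Infranilmanifold.proj_surjective⟩
  · refine isOpen_coinduced.2 ?_
    have h1 := hs.preimage hρ
    convert h1 using 1
    ext x
    exact iff_of_eq (congrArg (· ∈ s) (hmk x))

/-- `Γ` is torsion-free and point stabilizers in `N ⋊ G` are conjugate to the finite group `G`, so
`Γ` acts freely; discreteness then makes the projection a covering map. -/
theorem Infranilmanifold.isQuotientCoveringMap_proj [T2Space N] [Finite G]
    (hφ : ∀ g, Continuous (φ g)) (hΓ : IsInfranilGroup φ Γ) :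
    letI := infranilMulAction φ Γ
    IsQuotientCoveringMap (Infranilmanifold.proj φ Γ) Γ := by
  let := infranilMulAction φ Γ
  have := SemidirectProduct.isTopologicalGroup hφ
  have hT2 : T2Space (N ⋊[φ] G) := T2Space.of_injective_continuous
    SemidirectProduct.equivProd.injective continuous_induced_dom
  have := hΓ.discrete
  have hclosed : IsClosed (Γ : Set (N ⋊[φ] G)) := Subgroup.isClosed_of_discrete
  have hdisc : ∀ᶠ s in 𝓝 (1 : N ⋊[φ] G), s ∈ Γ → s = 1 := by
    have h1 : ({1} : Set Γ) ∈ 𝓝 (1 : Γ) := (isOpen_discrete _).mem_nhds rfl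
    rw [nhds_subtype_eq_comap] at h1
    obtain ⟨U, hU, hUs⟩ := mem_comap.1 h1
    filter_upwards [hU] with s hs hsΓ
    exact congrArg Subtype.val (hUs (show (⟨s, hsΓ⟩ : Γ) ∈ Subtype.val ⁻¹' U from hs))
  refine
    { toIsQuotientMap := Infranilmanifold.isQuotientMap_proj hφ
      continuous_const_smul := fun γ => continuous_infranilRightAct hφ _
      apply_eq_iff_mem_orbit := ?_
      disjoint := ?_ }
  · intro x y
    rw [eq_comm, Infranilmanifold.proj_eq_iff]
    constructor
    · rintro ⟨γ, hγ, rfl⟩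
      refine ⟨⟨γ, hγ⟩⁻¹, ?_⟩
      change infranilRightAct φ (γ⁻¹)⁻¹ y = _
      rw [inv_inv]
    · rintro ⟨γ, rfl⟩
      exact ⟨_, inv_mem γ.2, rfl⟩
  · intro x
    let f : G → N × N → N ⋊[φ] G := fun k p =>
      (SemidirectProduct.inl p.1)⁻¹ * SemidirectProduct.inr k * SemidirectProduct.inl p.2
    have hf : ∀ k, Continuous (f k) := fun k =>
      ((SemidirectProduct.continuous_inl.comp continuous_fst).inv.mul continuous_const).mul
        (SemidirectProduct.continuous_inl.comp continuous_snd)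
    have hev : ∀ k, ∀ᶠ p in 𝓝 (x, x), f k p ∈ Γ → f k p = 1 := by
      intro k
      by_cases hk : f k (x, x) ∈ Γ
      · have hfin : IsOfFinOrder (f k (x, x)) := by
          have h1 := (SemidirectProduct.inr : G →* N ⋊[φ] G).isOfFinOrder (isOfFinOrder_of_finite k)
          have h2 := (MulAut.conj (SemidirectProduct.inl x : N ⋊[φ] G)⁻¹).toMonoidHom.isOfFinOrder h1
          simpa [f] using h2
        have h1 := hΓ.torsionFree _ hk hfin
        have h2 : Tendsto (f k) (𝓝 (x, x)) (𝓝 1) := h1 ▸ (hf k).continuousAt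
        exact h2.eventually hdisc
      · have h1 := (hf k).continuousAt.eventually (hclosed.isOpen_compl.mem_nhds hk)
        filter_upwards [h1] with p hp hp'
        exact absurd hp' hp
    have hall := Filter.eventually_all.2 hev
    rw [nhds_prod_eq] at hall
    obtain ⟨U, hU, h2⟩ := (Filter.eventually_prod_self_iff
      (r := fun y z : N => ∀ k, f k (y, z) ∈ Γ → f k (y, z) = 1)).1 hall
    refine ⟨U, hU, ?_⟩
    rintro γ ⟨_, ⟨y, hy, rfl⟩, hy'⟩
    change infranilRightAct φ (γ : N ⋊[φ] G)⁻¹ y ∈ U at hy'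
    have h3 := inl_mul_eq_inr_mul_inl (γ : N ⋊[φ] G)⁻¹ y
    have h4 : f (γ : N ⋊[φ] G)⁻¹.right (y, infranilRightAct φ (γ : N ⋊[φ] G)⁻¹ y)
        = (γ : N ⋊[φ] G)⁻¹ := by
      simp only [f]
      rw [mul_assoc, ← h3, inv_mul_cancel_left]
    have h5 := h2 y hy _ hy' (γ : N ⋊[φ] G)⁻¹.right (by rw [h4]; exact inv_mem γ.2)
    rw [h4, inv_eq_one] at h5
    exact Subtype.ext h5

section Free

variable [T2Space N] [Finite G] (hφ : ∀ g, Continuous (φ g)) (hΓ : IsInfranilGroup φ Γ)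

include hφ hΓ

theorem Infranilmanifold.isCoveringMap_proj : IsCoveringMap (Infranilmanifold.proj φ Γ) :=
  letI := infranilMulAction φ Γ
  (Infranilmanifold.isQuotientCoveringMap_proj hφ hΓ).isCoveringMap

theorem IsInfranilGroup.eq_of_infranilRightAct_eq {γ γ' : N ⋊[φ] G} (hγ : γ ∈ Γ) (hγ' : γ' ∈ Γ)
    {x : N} (h : infranilRightAct φ γ x = infranilRightAct φ γ' x) : γ = γ' := by
  let := infranilMulAction φ Γ
  have := (Infranilmanifold.isQuotientCoveringMap_proj hφ hΓ).isCancelSMul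
  have h1 : (⟨γ, hγ⟩⁻¹ : Γ) • x = (⟨γ', hγ'⟩⁻¹ : Γ) • x := by
    change infranilRightAct φ (γ⁻¹)⁻¹ x = infranilRightAct φ (γ'⁻¹)⁻¹ x
    rwa [inv_inv, inv_inv]
  exact congrArg Subtype.val (inv_injective (IsCancelSMul.right_cancel _ _ _ h1))

/-- Two lifts of the same map `N → M` differ by a deck transformation. -/
theorem IsInfranilGroup.exists_eq_infranilRightAct [ConnectedSpace N] {f g : N → N}
    (hf : Continuous f) (hg : Continuous g)
    (hfg : ∀ x, Infranilmanifold.proj φ Γ (f x) = Infranilmanifold.proj φ Γ (g x)) :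
    ∃ γ ∈ Γ, ∀ x, infranilRightAct φ γ (f x) = g x := by
  obtain ⟨γ, hγ, h1⟩ := Infranilmanifold.proj_eq_iff.1 (hfg 1)
  refine ⟨γ, hγ, fun x => congrFun ((Infranilmanifold.isCoveringMap_proj hφ hΓ).eq_of_comp_eq
    (g₁ := fun x => infranilRightAct φ γ (f x))
    ((continuous_infranilRightAct hφ γ).comp hf) hg (funext fun x => ?_) 1 h1) x⟩
  simp only [Function.comp]
  rw [← hfg x]
  exact (Infranilmanifold.proj_eq_iff.2 ⟨γ, hγ, rfl⟩).symm

/-- A map homotopic to the identity lifts to a map of `N` commuting with `Γ`: lift the homotopy,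
starting from the identity of `N`. -/
theorem IsInfranilGroup.exists_equivariant_lift
    {h : C(Infranilmanifold φ Γ, Infranilmanifold φ Γ)}
    (hid : ContinuousMap.Homotopic h (ContinuousMap.id _)) :
    ∃ H : C(N, N), (∀ x, Infranilmanifold.proj φ Γ (H x) = h (Infranilmanifold.proj φ Γ x)) ∧
      ∀ γ ∈ Γ, ∀ x, H (infranilRightAct φ γ x) = infranilRightAct φ γ (H x) := by
  have hcov := Infranilmanifold.isCoveringMap_proj hφ hΓ
  obtain ⟨F⟩ := hid.symm
  let F' : C(I × N, Infranilmanifold φ Γ) :=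
    ⟨fun p => F (p.1, Infranilmanifold.proj φ Γ p.2),
      F.continuous.comp (continuous_fst.prodMk (hcov.continuous.comp continuous_snd))⟩
  have h0 : ∀ x, F' (0, x) = Infranilmanifold.proj φ Γ (ContinuousMap.id N x) := fun x =>
    F.apply_zero _
  let H' := hcov.liftHomotopy F' (ContinuousMap.id N) h0
  have hlift : ∀ p, Infranilmanifold.proj φ Γ (H' p) = F' p := fun p =>
    congrFun (hcov.liftHomotopy_lifts F' (ContinuousMap.id N) h0) p
  have hzero : ∀ x, H' (0, x) = x := fun x =>
    hcov.liftHomotopy_zero F' (ContinuousMap.id N) h0 x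
  refine ⟨⟨fun x => H' (1, x), H'.continuous.comp (continuous_const.prodMk continuous_id)⟩,
    fun x => (hlift _).trans (F.apply_one _), fun γ hγ x => ?_⟩
  have hinv : ∀ y, Infranilmanifold.proj φ Γ (infranilRightAct φ γ y)
      = Infranilmanifold.proj φ Γ y := fun y =>
    (Infranilmanifold.proj_eq_iff.2 ⟨γ, hγ, rfl⟩).symm
  refine congrFun (hcov.eq_of_comp_eq
    (g₁ := fun t : I => H' (t, infranilRightAct φ γ x))
    (g₂ := fun t : I => infranilRightAct φ γ (H' (t, x)))
    (H'.continuous.comp (continuous_id.prodMk continuous_const))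
    ((continuous_infranilRightAct hφ γ).comp
      (H'.continuous.comp (continuous_id.prodMk continuous_const))) (funext fun t => ?_) 0 ?_) 1
  · simp only [Function.comp]
    rw [hlift, hinv, hlift]
    change F (t, _) = F (t, _)
    rw [hinv]
  · simp only [hzero]

theorem IsInfranilGroup.exists_isCompact [LocallyCompactSpace N] :
    ∃ K : Set N, IsCompact K ∧ ∀ x, ∃ γ ∈ Γ, ∃ y ∈ K, infranilRightAct φ γ y = x := by
  have hcov := Infranilmanifold.isCoveringMap_proj hφ hΓ
  have := hΓ.cocompact
  have hM : CompactSpace (Infranilmanifold φ Γ) := by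
    let q : (N ⋊[φ] G) ⧸ Γ → Infranilmanifold φ Γ :=
      Quotient.lift (DoubleCoset.mk (SemidirectProduct.inr : G →* N ⋊[φ] G).range Γ) (by
        intro a b hab
        refine (DoubleCoset.eq _ _ _ _).2
          ⟨1, one_mem _, a⁻¹ * b, QuotientGroup.leftRel_apply.1 hab, ?_⟩
        group)
    have hq : Continuous q := Continuous.quotient_lift continuous_coinduced_rng _
    have hqs : Function.Surjective q := by
      intro m
      obtain ⟨s, rfl⟩ := Quotient.exists_rep m
      exact ⟨(s : (N ⋊[φ] G) ⧸ Γ), rfl⟩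
    exact hqs.compactSpace hq
  have hnhds : ∀ m : Infranilmanifold φ Γ, ∃ K : Set N, IsCompact K ∧
      Infranilmanifold.proj φ Γ '' K ∈ 𝓝 m := by
    intro m
    obtain ⟨x, rfl⟩ := Infranilmanifold.proj_surjective m
    obtain ⟨K, hK, hxK⟩ := exists_compact_mem_nhds x
    exact ⟨K, hK, hcov.isOpenMap.image_mem_nhds hxK⟩
  choose K hK hKm using hnhds
  obtain ⟨t, -, ht⟩ := isCompact_univ.elim_nhds_subcover _ fun m _ => hKm m
  refine ⟨⋃ m ∈ t, K m, t.isCompact_biUnion fun m _ => hK m, fun x => ?_⟩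
  obtain ⟨m, hm, y, hy, hyx⟩ := Set.mem_iUnion₂.1
    (ht (Set.mem_univ (Infranilmanifold.proj φ Γ x)))
  obtain ⟨γ, hγ, h⟩ := Infranilmanifold.proj_eq_iff.1 hyx
  exact ⟨γ, hγ, y, Set.mem_iUnion₂.2 ⟨m, hm, hy⟩, h⟩

/-- A continuous map commuting with `Γ` is at bounded distance from the identity. -/
theorem IsInfranilGroup.exists_isCompact_mul_inv_mem [LocallyCompactSpace N] {f : N → N}
    (hf : Continuous f)
    (hfΓ : ∀ γ ∈ Γ, ∀ x, f (infranilRightAct φ γ x) = infranilRightAct φ γ (f x)) :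
    ∃ K : Set N, IsCompact K ∧ ∀ x, f x * x⁻¹ ∈ K := by
  obtain ⟨K, hK, hKΓ⟩ := hΓ.exists_isCompact hφ
  refine ⟨⋃ k : G, φ k '' ((fun x => f x * x⁻¹) '' K), isCompact_iUnion fun k =>
    (hK.image (hf.mul continuous_id.inv)).image (hφ k), fun x => ?_⟩
  obtain ⟨γ, hγ, y, hy, rfl⟩ := hKΓ x
  refine Set.mem_iUnion.2 ⟨γ.right⁻¹, _, ⟨y, hy, rfl⟩, ?_⟩
  rw [hfΓ γ hγ]
  simp only [infranilRightAct]
  rw [← map_inv, ← map_mul]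
  congr 1
  group

/-- A path of elements of `N` fixed by the holonomy acts on the quotient by left translations. -/
theorem IsInfranilGroup.exists_translation (p : C(I, N))
    (hp : ∀ t, ∀ γ ∈ Γ, φ γ.right (p t) = p t) :
    ∃ F : C(I × Infranilmanifold φ Γ, Infranilmanifold φ Γ),
      ∀ t x, F (t, Infranilmanifold.proj φ Γ x) = Infranilmanifold.proj φ Γ (p t * x) := by
  have hcov := Infranilmanifold.isCoveringMap_proj hφ hΓ
  have hq : IsOpenQuotientMap (Infranilmanifold.proj φ Γ) :=
    ⟨Infranilmanifold.proj_surjective, hcov.continuous, hcov.isOpenMap⟩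
  let q : C(I × N, I × Infranilmanifold φ Γ) :=
    ⟨Prod.map id (Infranilmanifold.proj φ Γ), continuous_id.prodMap hcov.continuous⟩
  have hqq : IsQuotientMap q := (IsOpenQuotientMap.id.prodMap hq).isQuotientMap
  let g : C(I × N, Infranilmanifold φ Γ) :=
    ⟨fun y => Infranilmanifold.proj φ Γ (p y.1 * y.2), hcov.continuous.comp
      ((p.continuous.comp continuous_fst).mul continuous_snd)⟩
  have hg : Function.FactorsThrough g q := by
    rintro ⟨t, x⟩ ⟨t', y⟩ hxy
    obtain ⟨rfl, h2⟩ := Prod.mk.inj hxy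
    obtain ⟨γ, hγ, rfl⟩ := Infranilmanifold.proj_eq_iff.1 h2
    refine Infranilmanifold.proj_eq_iff.2 ⟨γ, hγ, ?_⟩
    have h3 : φ γ.right⁻¹ (p t) = p t := by
      have := hp t γ⁻¹ (inv_mem hγ)
      rwa [SemidirectProduct.inv_right] at this
    simp only [infranilRightAct, mul_assoc, map_mul]
    rw [h3]
    rfl
  refine ⟨hqq.lift g hg, fun t x => ?_⟩
  exact congrArg (fun k : C(I × N, Infranilmanifold φ Γ) => k (t, x)) (hqq.lift_comp g hg)

end Free

end Covering

/-! ### Affine maps and centralizers of Anosov automorphisms -/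

section Affine

open Filter Topology
open scoped unitInterval Pointwise

theorem iterate_affine {N : Type*} [Group N] {f : N → N} {A : MulAut N}
    (hf : ∀ x, f x = A x * f 1) (n : ℕ) (x : N) : f^[n] x = (A ^ n) x * f^[n] 1 := by
  induction n generalizing x with
  | zero => simp
  | succ n ih =>
    rw [Function.iterate_succ_apply, Function.iterate_succ_apply, ih (f x), ih (f 1), hf x,
      map_mul, pow_succ, MulAut.mul_apply, mul_assoc]

/-- If `X ^ n * (Y ^ n)⁻¹` ranges over a finite set, then some positive powers of `X` and `Y`
agree. -/
theorem exists_pow_eq_pow {M : Type*} [Group M] {X Y : M} {s : Set M} (hs : s.Finite)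
    (h : ∀ n : ℕ, X ^ n * (Y ^ n)⁻¹ ∈ s) : ∃ n, 0 < n ∧ X ^ n = Y ^ n := by
  have := hs.to_subtype
  obtain ⟨i, j, hij, he⟩ := Finite.exists_ne_map_eq_of_infinite
    fun n : ℕ => (⟨X ^ n * (Y ^ n)⁻¹, h n⟩ : s)
  have he' : X ^ i * (Y ^ i)⁻¹ = X ^ j * (Y ^ j)⁻¹ := congrArg Subtype.val he
  have key : ∀ i j : ℕ, i < j → X ^ i * (Y ^ i)⁻¹ = X ^ j * (Y ^ j)⁻¹ →
      ∃ n, 0 < n ∧ X ^ n = Y ^ n := by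
    intro i j hij he
    obtain ⟨d, rfl⟩ := Nat.exists_eq_add_of_lt hij
    refine ⟨d + 1, d.succ_pos, ?_⟩
    rw [add_assoc, pow_add X, pow_add Y, mul_inv_rev, mul_assoc, ← mul_assoc (X ^ (d + 1))] at he
    have h1 := mul_left_cancel he
    rw [eq_comm, mul_eq_right] at h1
    exact mul_inv_eq_one.1 h1
  rcases lt_or_gt_of_ne hij with h1 | h1
  · exact key i j h1 he'
  · exact key j i h1 he'.symm

variable {N G : Type*} [Group N] [Group G] {φ : G →* MulAut N} {Γ : Subgroup (N ⋊[φ] G)}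

theorem NormalizesInfranilGroup.iterate {T : N → N} (hT : NormalizesInfranilGroup φ Γ T) (n : ℕ) :
    NormalizesInfranilGroup φ Γ T^[n] := by
  induction n with
  | zero => exact ⟨fun γ hγ => ⟨γ, hγ, fun x => rfl⟩, fun γ hγ => ⟨γ, hγ, fun x => rfl⟩⟩
  | succ n ih =>
    constructor
    · intro γ hγ
      obtain ⟨γ₁, h₁, e₁⟩ := ih.1 γ hγ
      obtain ⟨γ₂, h₂, e₂⟩ := hT.1 γ₁ h₁
      exact ⟨γ₂, h₂, fun x => by
        rw [Function.iterate_succ_apply', e₁, e₂, Function.iterate_succ_apply']⟩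
    · intro γ hγ
      obtain ⟨γ₁, h₁, e₁⟩ := hT.2 γ hγ
      obtain ⟨γ₂, h₂, e₂⟩ := ih.2 γ₁ h₁
      exact ⟨γ₂, h₂, fun x => by
        rw [Function.iterate_succ_apply', e₂, e₁, Function.iterate_succ_apply']⟩

/-- Iterates of `γ ∘ T` and of `T` differ by elements of `Γ`. -/
theorem NormalizesInfranilGroup.exists_iterate_comp {T : N → N}
    (hT : NormalizesInfranilGroup φ Γ T) {γ : N ⋊[φ] G} (hγ : γ ∈ Γ) (n : ℕ) :
    ∃ γ' ∈ Γ, ∀ x, (fun x => infranilRightAct φ γ (T x))^[n] x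
      = infranilRightAct φ γ' (T^[n] x) := by
  induction n with
  | zero => exact ⟨1, one_mem _, fun x => (infranilRightAct_one x).symm⟩
  | succ n ih =>
    obtain ⟨γ₁, h₁, e₁⟩ := ih
    obtain ⟨γ₂, h₂, e₂⟩ := (hT.iterate n).1 γ hγ
    refine ⟨γ₂ * γ₁, mul_mem h₂ h₁, fun x => ?_⟩
    rw [Function.iterate_succ_apply, e₁, e₂, infranilRightAct_mul, Function.iterate_succ_apply]

/-- Let `H` commute with `Γ` and with an affine map `T` normalizing `Γ`, up to an element of `Γ`.
Then `H` commutes with a positive power of `T` up to a right translation which commutes with `Γ`.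
The linear parts of the elements of `Γ` relating `H ∘ T ^ n` to `T ^ n ∘ H` are a cocycle with
values in a finite group. -/
theorem exists_iterate_comm {H T : N → N} [Finite G]
    (hfree : ∀ γ ∈ Γ, ∀ γ' ∈ Γ, ∀ x, infranilRightAct φ γ x = infranilRightAct φ γ' x → γ = γ')
    (hT : NormalizesInfranilGroup φ Γ T) {A : MulAut N} (hTA : ∀ x, T x = A x * T 1)
    (hH : ∀ γ ∈ Γ, ∀ x, H (infranilRightAct φ γ x) = infranilRightAct φ γ (H x))
    {γ : N ⋊[φ] G} (hγ : γ ∈ Γ) (hHT : ∀ x, H (T x) = infranilRightAct φ γ (T (H x))) :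
    ∃ n, 0 < n ∧ ∃ m : N, (∀ x, H (T^[n] x) = T^[n] (H x) * m) ∧
      ∀ γ ∈ Γ, ∀ x, infranilRightAct φ γ x * m = infranilRightAct φ γ (x * m) := by
  set S : N → N := fun x => infranilRightAct φ γ (T x) with hS
  have hSA : ∀ x, S x = (φ γ.right⁻¹ * A) x * S 1 := by
    intro x
    simp only [hS, infranilRightAct, MulAut.mul_apply]
    rw [hTA x, ← map_mul]
    group
  have hST : ∀ n, ∃ γ' ∈ Γ, ∀ x, S^[n] x = infranilRightAct φ γ' (T^[n] x) :=
    hT.exists_iterate_comp hγ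
  have hlin : ∀ n, ∀ γ' : N ⋊[φ] G, (∀ x, S^[n] x = infranilRightAct φ γ' (T^[n] x)) →
      (φ γ.right⁻¹ * A) ^ n * (A ^ n)⁻¹ = φ γ'.right⁻¹ := by
    intro n γ' h
    rw [mul_inv_eq_iff_eq_mul]
    ext x
    have h1 := h x
    rw [iterate_affine hSA, iterate_affine hTA, h 1] at h1
    simp only [infranilRightAct, mul_assoc, map_mul] at h1
    rw [MulAut.mul_apply]
    exact mul_right_cancel h1
  obtain ⟨n, hn, hpow⟩ := exists_pow_eq_pow (X := φ γ.right⁻¹ * A) (Y := A)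
    (Set.finite_range φ) fun n => by
      obtain ⟨γ', -, h⟩ := hST n
      exact ⟨_, (hlin n γ' h).symm⟩
  obtain ⟨γ', hγ', h⟩ := hST n
  have hright : φ γ'.right⁻¹ = 1 := by rw [← hlin n γ' h, hpow, mul_inv_cancel]
  have hact : ∀ x, infranilRightAct φ γ' x = x * γ'.left := by
    intro x; simp only [infranilRightAct, hright, MulAut.one_apply]
  have hHn : ∀ x, H (T^[n] x) = infranilRightAct φ γ' (T^[n] (H x)) := by
    intro x
    rw [← h]
    exact Function.Semiconj.iterate_right (f := H) (ga := T) (gb := S) hHT n x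
  refine ⟨n, hn, γ'.left, fun x => (hHn x).trans (hact _), fun γ₁ hγ₁ x => ?_⟩
  -- both orders of composition agree at one point, hence everywhere
  obtain ⟨γ₂, hγ₂, h₂⟩ := (hT.iterate n).2 γ₁ hγ₁
  have hcomm : γ₁ * γ' = γ' * γ₁ := by
    refine hfree _ (mul_mem hγ₁ hγ') _ (mul_mem hγ' hγ₁) (T^[n] (H 1)) ?_
    rw [infranilRightAct_mul, infranilRightAct_mul, ← h₂, ← hH γ₂ hγ₂, ← hHn, h₂, hH γ₁ hγ₁, hHn]
  rw [← hact, ← hact, ← infranilRightAct_mul, ← infranilRightAct_mul, hcomm]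

end Affine

section Main

open Filter Topology
open scoped unitInterval Pointwise

universe u

variable {E : Type*} [NormedAddCommGroup E] [NormedSpace ℝ E] [FiniteDimensional ℝ E]
  {N : Type u} [TopologicalSpace N] [ChartedSpace E N] [Group N]
  [LieGroup 𝓘(ℝ, E) ∞ N] [Group.IsNilpotent N]

/-- Data on the linear part `x ↦ v * A x * v⁻¹` of an affine map with hyperbolic `A`: it is again
hyperbolic. -/
theorem exists_hasDerivAtOne_conj_mul {A : MulAut N} (hA : IsLieAutomorphism (E := E) A)
    (hAh : IsHyperbolicAut (E := E) A) (v : N) :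
    ∃ D D' : E →L[ℝ] E, HasDerivAtOne (MulAut.conj v * A : MulAut N) D ∧
      HasDerivAtOne ((MulAut.conj v * A)⁻¹ : MulAut N) D' ∧ IsHyperbolicEnd D.toLinearMap := by
  obtain ⟨D, hDA, hD⟩ := hA.1.hasDerivAtOne (map_one A)
  obtain ⟨D', -, hD'⟩ := hA.2.hasDerivAtOne (map_one A⁻¹)
  refine ⟨adjointAction E v * D, D' * adjointAction E v⁻¹, (hasDerivAtOne_conj v).comp hD, ?_, ?_⟩
  · have h1 : ((MulAut.conj v * A)⁻¹ : MulAut N) = (A⁻¹ : MulAut N) ∘ fun x => v⁻¹ * x * v⁻¹⁻¹ := by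
      funext x
      rw [mul_inv_rev, MulAut.mul_apply, ← map_inv]
      rfl
    rw [h1]
    exact hD'.comp (hasDerivAtOne_conj v⁻¹)
  · obtain ⟨c, hc⟩ := exists_prod_adjointAction_sub_one_eq_zero (E := E) (N := N)
    have hDh : IsHyperbolicEnd D.toLinearMap := hDA ▸ hAh
    refine hDh.unipotent_mul (R := fun x : N => (adjointAction E x).toLinearMap) (c := c) ?_
      A.surjective (fun x => ?_) v
    · intro l hl
      have := congrArg (ContinuousLinearMap.toLinearMapRingHom : (E →L[ℝ] E) →+* (E →ₗ[ℝ] E)) (hc l hl)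
      rw [map_list_prod, List.map_map, map_zero] at this
      exact this
    · exact congrArg (fun T : E →L[ℝ] E => T.toLinearMap) (adjointAction_comm hD x)

/-- If `H` commutes with an affine map `f` with hyperbolic linear part, up to a central
translation, and is at bounded distance from the identity, then it is a left translation. -/
theorem IsSquareRoot.eq_translation [ConnectedSpace N] {r : N → N} (hr : IsSquareRoot r) {f H : N → N} {B : MulAut N}
    {D D' : E →L[ℝ] E} (hB : HasDerivAtOne B D) (hB' : HasDerivAtOne (B⁻¹ : MulAut N) D')
    (hD : IsHyperbolicEnd D.toLinearMap) (hf : ∀ x, f x = B x * f 1)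
    {m : N} (hm : m ∈ Subgroup.center N) (hH : ∀ x, H (f x) = f (H x) * m)
    {K : Set N} (hK : IsCompact K) (hHK : ∀ x, H x * x⁻¹ ∈ K) (x : N) : H x = H 1 * x := by
  have := topologicalGroup_of_lieGroup 𝓘(ℝ, E) ∞ (G := N)
  set c : N → N := fun x => H x * x⁻¹ with hc
  have hcf : ∀ x, c (f x) = B (c x) * m := by
    intro x
    have h1 := Subgroup.mem_center_iff.1 hm (f x)⁻¹
    simp only [hc]
    rw [hH, mul_assoc, ← h1, ← mul_assoc, hf (H x), hf x, map_mul, map_inv]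
    group
  have hdiff : ∀ x y, c (f x) * (c (f y))⁻¹ = B (c x * (c y)⁻¹) := by
    intro x y
    rw [hcf, hcf, map_mul B (c x) (c y)⁻¹, map_inv]
    group
  have hfs : Function.Surjective f := by
    intro y
    obtain ⟨x, hx⟩ := B.surjective (y * (f 1)⁻¹)
    exact ⟨x, by rw [hf, hx]; group⟩
  have horb : ∀ (n : ℤ) (x y : N), ∃ x' y', (B ^ n) (c x * (c y)⁻¹) = c x' * (c y')⁻¹ := by
    intro n
    induction n using Int.induction_on with
    | zero => exact fun x y => ⟨x, y, rfl⟩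
    | succ n ih =>
      intro x y
      obtain ⟨x', y', h⟩ := ih x y
      exact ⟨f x', f y', by rw [add_comm, zpow_add, zpow_one, MulAut.mul_apply, h, hdiff]⟩
    | pred n ih =>
      intro x y
      obtain ⟨x', y', h⟩ := ih x y
      obtain ⟨x', rfl⟩ := hfs x'
      obtain ⟨y', rfl⟩ := hfs y'
      refine ⟨x', y', ?_⟩
      rw [sub_eq_neg_add, zpow_add, MulAut.mul_apply, h, hdiff, zpow_neg_one,
        MulAut.inv_apply_self]
  have hone : c x * (c 1)⁻¹ = 1 := by
    refine hr.eq_one_of_zpow_mem hB hB' hD (hK.mul hK.inv) fun n => ?_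
    obtain ⟨x', y', h⟩ := horb n x 1
    rw [h]
    exact Set.mul_mem_mul (hHK x') (Set.inv_mem_inv.2 (hHK y'))
  have h2 := mul_inv_eq_one.1 hone
  simp only [hc, inv_one, mul_one] at h2
  rw [← h2]; group

end Main

open scoped unitInterval in
theorem IsInfranilGroup.areIsotopic_of_path {N G : Type*} [Group N] [TopologicalSpace N]
    [IsTopologicalGroup N] [T2Space N] [Group G] [Finite G] [TopologicalSpace G]
    [DiscreteTopology G] {φ : G →* MulAut N} {Γ : Subgroup (N ⋊[φ] G)}
    (hφ : ∀ g, Continuous (φ g)) (hΓ : IsInfranilGroup φ Γ)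
    {h : Infranilmanifold φ Γ ≃ₜ Infranilmanifold φ Γ} (p : C(I, N)) (hp1 : p 1 = 1)
    (hp : ∀ t, ∀ γ ∈ Γ, φ γ.right (p t) = p t)
    (hh : ∀ x, h (Infranilmanifold.proj φ Γ x) = Infranilmanifold.proj φ Γ (p 0 * x)) :
    AreIsotopic h (Homeomorph.refl (Infranilmanifold φ Γ)) := by
  obtain ⟨F, hF⟩ := hΓ.exists_translation hφ p hp
  obtain ⟨F', hF'⟩ := hΓ.exists_translation hφ ⟨fun t => (p t)⁻¹, p.continuous.inv⟩
    fun t γ hγ => by simp [hp t γ hγ]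
  refine ⟨{ toFun := F
            continuous_toFun := F.continuous
            map_zero_left := fun m => ?_
            map_one_left := fun m => ?_
            prop' := fun t => ?_ }⟩
  · obtain ⟨x, rfl⟩ := Infranilmanifold.proj_surjective m
    exact (hF 0 x).trans (hh x).symm
  · obtain ⟨x, rfl⟩ := Infranilmanifold.proj_surjective m
    refine (hF 1 x).trans ?_
    rw [hp1, one_mul]
    rfl
  · refine isHomeomorph_iff_exists_inverse.2 ⟨ContinuousMap.continuous _, fun m => F' (t, m),
      fun m => ?_, fun m => ?_, F'.continuous.comp (continuous_const.prodMk continuous_id)⟩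
    · obtain ⟨x, rfl⟩ := Infranilmanifold.proj_surjective m
      change F' (t, F (t, _)) = _
      rw [hF, hF']
      simp
    · obtain ⟨x, rfl⟩ := Infranilmanifold.proj_surjective m
      change F (t, F' (t, _)) = _
      rw [hF', hF]
      simp

theorem proposition7
    {E : Type*} [NormedAddCommGroup E] [NormedSpace ℝ E] [FiniteDimensional ℝ E]
    {N : Type*} [TopologicalSpace N] [T2Space N] [SecondCountableTopology N] [ChartedSpace E N]
    [Group N] [LieGroup 𝓘(ℝ, E) ∞ N] [SimplyConnectedSpace N] [Group.IsNilpotent N]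
    {G : Type*} [Group G] [Finite G] [TopologicalSpace G] [DiscreteTopology G]
    (φ : G →* MulAut N) (hφ : ∀ g : G, IsLieAutomorphism (E := E) (φ g))
    (Γ : Subgroup (N ⋊[φ] G)) (hΓ : IsInfranilGroup φ Γ)
    (L : Infranilmanifold φ Γ → Infranilmanifold φ Γ)
    (hL : IsAnosovAutomorphism (E := E) φ Γ L)
    (h : Infranilmanifold φ Γ ≃ₜ Infranilmanifold φ Γ)
    (hid : ContinuousMap.Homotopic
      (h : C(Infranilmanifold φ Γ, Infranilmanifold φ Γ)) (ContinuousMap.id _))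
    (hcomm : ∀ m, h (L m) = L (h m)) :
    AreIsotopic h (Homeomorph.refl (Infranilmanifold φ Γ)) := by
  have := topologicalGroup_of_lieGroup 𝓘(ℝ, E) ∞ (G := N)
  have := ChartedSpace.locallyCompactSpace E N
  have hφc : ∀ g, Continuous (φ g) := fun g => (hφ g).1.continuous
  obtain ⟨r, hr⟩ := exists_isSquareRoot E N
  obtain ⟨v, A, hA, hAh, hT, hLT⟩ := hL
  set T : N → N := fun x => v * A x with hTdef
  have hTA : ∀ x, T x = (MulAut.conj v * A) x * T 1 := by
    intro x
    simp [hTdef]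
  have hTc : Continuous T := continuous_const.mul hA.1.continuous
  obtain ⟨H, hHh, hHΓ⟩ := hΓ.exists_equivariant_lift hφc hid
  -- `H ∘ T` and `T ∘ H` are both lifts of `h ∘ L = L ∘ h`
  obtain ⟨γ, hγ, hHT⟩ := hΓ.exists_eq_infranilRightAct hφc (f := fun x => T (H x))
    (g := fun x => H (T x)) (hTc.comp H.continuous) (H.continuous.comp hTc) (by
      intro x
      rw [← hLT, hHh, hHh, ← hLT]
      exact (hcomm _).symm)
  obtain ⟨n, hn, m, hHn, hmΓ⟩ := exists_iterate_comm
    (fun γ hγ γ' hγ' x => hΓ.eq_of_infranilRightAct_eq hφc hγ hγ') hT hTA hHΓ hγ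
    fun x => (hHT x).symm
  have hm : m ∈ Subgroup.center N := by
    obtain ⟨K, hK, hmK⟩ := hΓ.exists_isCompact_mul_inv_mem hφc (f := fun x => x * m)
      (continuous_id.mul continuous_const) hmΓ
    exact hr.mem_center_of_conj_mem E hK hmK
  obtain ⟨K, hK, hHK⟩ := hΓ.exists_isCompact_mul_inv_mem hφc H.continuous hHΓ
  obtain ⟨D, D', hD, hD', hDh⟩ := exists_hasDerivAtOne_conj_mul hA hAh v
  have htrans : ∀ x, H x = H 1 * x := by
    refine hr.eq_translation (f := T^[n]) (B := (MulAut.conj v * A) ^ n) (hD.mulAut_pow n)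
      (D' := D' ^ n) ?_ ?_ (iterate_affine hTA n) hm hHn hK hHK
    · rw [← inv_pow]
      exact hD'.mulAut_pow n
    · rw [ContinuousLinearMap.toLinearMap_pow]
      exact hDh.pow hn
  -- the translation commutes with `Γ`, hence is by an element fixed by the holonomy
  let P : Subgroup (MulAut N) := (Γ.map SemidirectProduct.rightHom).map φ
  have hfix : ∀ B ∈ P, B (H 1) = H 1 := by
    rintro _ ⟨_, ⟨γ, hγ, rfl⟩, rfl⟩
    have h1 := hHΓ γ⁻¹ (inv_mem hγ) 1
    rw [htrans] at h1
    simp only [infranilRightAct, map_mul, one_mul, SemidirectProduct.inv_right,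
      inv_inv] at h1
    exact (mul_right_cancel h1).symm
  have : Finite P := ((Set.finite_range φ).subset fun B hB => by
    obtain ⟨k, -, rfl⟩ := hB
    exact ⟨k, rfl⟩).to_subtype
  obtain ⟨p, hp0, hp1, hp⟩ := hr.exists_fixed_path P (fun B hB => by
    obtain ⟨k, -, rfl⟩ := hB
    exact (hφ k).1) hfix
  refine hΓ.areIsotopic_of_path hφc p hp1 (fun t γ hγ => hp t _ ⟨_, ⟨γ, hγ, rfl⟩, rfl⟩) fun x => ?_
  rw [hp0, ← htrans, hHh]
  rfl
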